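/- Let $p>2$ be a prime, let $d\ge 0$ be an integer, and let $V$ be an $\mathbb{F}_p$-vector space of dimension $2(d+1)$ with a nondegenerate symmetric bilinear form $[\cdot,\cdot]$ that is nonsplit, i.e. $V$ has no totally isotropic subspace of dimension $d+1$. For $0\le r\le 2(d+1)$ and an $\mathbb{F}_{p^2}$-scheme $S$, let $\mathrm{Gr}(r,V)(S)$ be the set of quasi-coherent submodules of $V\otimes_{\mathbb{F}_p}\mathcal{O}_S$ that are locally direct summands of rank $r$. Let $\mathrm{OGr}(d+1)$ be the functor from $\mathbb{F}_{p^2}$-schemes to sets carrying $S$ to the set of totally isotropic elements of $\mathrm{Gr}(d+1,V)(S)$. Let $\mathscr{Y}_V$ be the functor carrying $S$ to the set of pairs $(\mathcal{L}_d,\mathcal{L}_{d+1})$ of totally isotropic elements $\mathcal{L}_d\in\mathrm{Gr}(d,V)(S)$ and $\mathcal{L}_{d+1}\in\mathrm{Gr}(d+1,V)(S)$ such that $\mathcal{L}_d\subseteq\mathcal{L}_{d+1}$, $\mathcal{L}_d\subseteq\mathrm{Frob}^*\mathcal{L}_{d+1}$, and $\mathcal{L}_{d+1}+\mathrm{Frob}^*\mathcal{L}_{d+1}\subseteq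 V\otimes\mathcal{O}_S$ is locally a direct summand, where $\mathrm{Frob}\colon S\to S$ is the absolute $p$-power Frobenius and $\mathrm{Frob}^*(V\otimes\mathcal{O}_S)$ is identified with $V\otimes\mathcal{O}_S$. Then both functors are representable by $\mathbb{F}_{p^2}$-schemes, and the morphism $\mathscr{Y}_V\to\mathrm{OGr}(d+1)$ of the representing schemes induced by the forgetful map $(\mathcal{L}_d,\mathcal{L}_{d+1})\mapsto\mathcal{L}_{d+1}$ is a closed immersion. -/

import Mathlib

open CategoryTheory AlgebraicGeometry Opposite TensorProduct

universe u

namespace OrthDL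

noncomputable section

variable (p : ℕ) [Fact p.Prime] (V : Type u) [AddCommGroup V] [Module (ZMod p) V]

/-- The morphism of affine schemes `Spec R' ⟶ Spec R` given by a homomorphism `R ⟶ R'` of
commutative `𝔽_p`-algebras. -/
abbrev specMap {R R' : CommAlgCat.{0} (ZMod p)} (f : R ⟶ R') :
    Spec (CommRingCat.of R') ⟶ Spec (CommRingCat.of R) :=
  Spec.map (CommRingCat.ofHom f.hom.toRingHom)

/-- The `p`-power Frobenius endomorphism of a commutative `𝔽_p`-algebra. -/
abbrev frobRing (R : CommAlgCat.{0} (ZMod p)) : R ⟶ R :=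
  CommAlgCat.ofHom (FiniteField.frobeniusAlgHom (ZMod p) R)

/-- For a scheme `S` of characteristic `p`, an element of `Gr(r, V)(S)`: a quasi-coherent
submodule `𝓛` of `V ⊗ 𝒪_S` which is locally a direct summand of rank `r`.

It is given by its pull-backs to all affine schemes over `S`: for each `x : Spec R ⟶ S`, the
submodule `x^*𝓛` of `R ⊗ V`, compatible with base change along `R → R'`. (Every ring `R` with a
morphism `Spec R ⟶ S` is an `𝔽_p`-algebra in a unique way.) Over `Spec R` a submodule of `R ⊗ V` is
locally a direct summand of rank `r` if and only if the quotient is finite projective of constant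
rank `dim V - r`; the sets of such submodules and the base change maps between them are Mathlib's
Grassmannian functor, which is indexed by the rank of the quotient. It is meant for
`0 ≤ r ≤ dim V`. -/
@[ext]
structure Subbundle (r : ℕ) (S : Scheme.{0}) where
  /-- the pull-back `x^*𝓛` along `x : Spec R ⟶ S` -/
  fiber (R : CommAlgCat.{0} (ZMod p)) (x : Spec (CommRingCat.of R) ⟶ S) :
    Module.Grassmannian R (R ⊗[ZMod p] V) (Module.finrank (ZMod p) V - r)
  fiber_map {R R' : CommAlgCat.{0} (ZMod p)} (f : R ⟶ R') (x : Spec (CommRingCat.of R) ⟶ S) :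
    fiber R' (specMap p f ≫ x) = Module.Grassmannian.map f.hom (fiber R x)

namespace Subbundle

variable {p V} {r : ℕ} {S T : Scheme.{0}}

/-- The submodule `x^*𝓛` of `R ⊗ V`. -/
abbrev at' (L : Subbundle p V r S) (R : CommAlgCat.{0} (ZMod p))
    (x : Spec (CommRingCat.of R) ⟶ S) : Submodule R (R ⊗[ZMod p] V) :=
  (L.fiber R x).toSubmodule

/-- The pull-back `g^*𝓛 ⊆ V ⊗ 𝒪_T` along `g : T ⟶ S`. -/
def pullback (g : T ⟶ S) (L : Subbundle p V r S) : Subbundle p V r T where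
  fiber R x := L.fiber R (x ≫ g)
  fiber_map f x := by rw [Category.assoc]; exact L.fiber_map f (x ≫ g)

theorem pullback_id (L : Subbundle p V r S) : L.pullback (𝟙 S) = L := by
  ext R x : 3
  simp [pullback]

theorem pullback_comp {T' : Scheme.{0}} (h : T' ⟶ T) (g : T ⟶ S) (L : Subbundle p V r S) :
    L.pullback (h ≫ g) = (L.pullback g).pullback h := by
  ext R x : 3
  simp [pullback]

/-- The pull-back `Frob^*𝓛 ⊆ Frob^*(V ⊗ 𝒪_S) = V ⊗ 𝒪_S` along the absolute `p`-power Frobenius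
`Frob : S ⟶ S`. The composite of `x : Spec R ⟶ S` and `Frob` is the composite of the Frobenius of
`Spec R` and `x`. -/
def frob (L : Subbundle p V r S) : Subbundle p V r S where
  fiber R x := L.fiber R (specMap p (frobRing p R) ≫ x)
  fiber_map {R R'} f x := by
    have h : specMap p (frobRing p R') ≫ specMap p f =
        specMap p f ≫ specMap p (frobRing p R) := by
      rw [← Spec.map_comp, ← Spec.map_comp]
      congr 1
      ext a
      exact (map_pow f.hom a _).symm
    rw [← Category.assoc, h, Category.assoc]
    exact L.fiber_map f _

/-- `𝓛` is totally isotropic for the `𝒪_S`-bilinear extension of the form `B` on `V`. -/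
def IsIsotropic (B : LinearMap.BilinForm (ZMod p) V) (L : Subbundle p V r S) : Prop :=
  ∀ (R : CommAlgCat.{0} (ZMod p)) (x : Spec (CommRingCat.of R) ⟶ S),
    ∀ u ∈ L.at' R x, ∀ v ∈ L.at' R x, LinearMap.BilinForm.baseChange R B u v = 0

/-- The inclusion `𝓛 ⊆ 𝓛'` of submodules of `V ⊗ 𝒪_S`. -/
def IsSub {r' : ℕ} (L : Subbundle p V r S) (L' : Subbundle p V r' S) : Prop :=
  ∀ (R : CommAlgCat.{0} (ZMod p)) (x : Spec (CommRingCat.of R) ⟶ S), L.at' R x ≤ L'.at' R x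

/-- The sum `𝓛 + 𝓛' ⊆ V ⊗ 𝒪_S` is locally a direct summand. This is tested on all affine schemes
`x : Spec R ⟶ S` over `S`: the image of `x^*(𝓛 + 𝓛')` in `R ⊗ V` is `x^*𝓛 + x^*𝓛'`, and over an
affine scheme a finitely generated submodule of `R ⊗ V` is locally a direct summand if and only if
it is a direct summand. -/
def SumIsSummand {r' : ℕ} (L : Subbundle p V r S) (L' : Subbundle p V r' S) : Prop :=
  ∀ (R : CommAlgCat.{0} (ZMod p)) (x : Spec (CommRingCat.of R) ⟶ S),
    ∃ N : Submodule R (R ⊗[ZMod p] V), IsCompl (L.at' R x ⊔ L'.at' R x) N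

end Subbundle

/-- The base scheme `Spec 𝔽_{p²}`. -/
abbrev base : Scheme.{0} := Spec (CommRingCat.of (GaloisField p 2))

variable {p V}

/-- The functor `OGr(r)` on `𝔽_{p²}`-schemes: totally isotropic elements of `Gr(r, V)(S)`. -/
def OGr (B : LinearMap.BilinForm (ZMod p) V) (r : ℕ) :
    (Over (base p))ᵒᵖ ⥤ Type (max 1 u) where
  obj S := {L : Subbundle p V r S.unop.left // L.IsIsotropic B}
  map g := ↾fun L => ⟨L.1.pullback g.unop.left, fun R x => L.2 R (x ≫ g.unop.left)⟩
  map_id S := by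
    refine ConcreteCategory.hom_ext _ _ fun L => ?_
    exact Subtype.ext (Subbundle.pullback_id _)
  map_comp g h := by
    refine ConcreteCategory.hom_ext _ _ fun L => ?_
    exact Subtype.ext (Subbundle.pullback_comp _ _ _)

/-- The functor `𝒴_V` on `𝔽_{p²}`-schemes: pairs `𝓛_d ⊆ 𝓛_{d+1}` of totally isotropic elements
of `Gr(d, V)(S)` and `Gr(d+1, V)(S)` such that `𝓛_d ⊆ Frob^*𝓛_{d+1}` and that
`𝓛_{d+1} + Frob^*𝓛_{d+1}` is locally a direct summand of `V ⊗ 𝒪_S`. -/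
def YV (B : LinearMap.BilinForm (ZMod p) V) (d : ℕ) :
    (Over (base p))ᵒᵖ ⥤ Type (max 1 u) where
  obj S := {L : Subbundle p V d S.unop.left × Subbundle p V (d + 1) S.unop.left //
    L.1.IsIsotropic B ∧ L.2.IsIsotropic B ∧ L.1.IsSub L.2 ∧ L.1.IsSub L.2.frob ∧
      L.2.SumIsSummand L.2.frob}
  map g := ↾fun L => ⟨(L.1.1.pullback g.unop.left, L.1.2.pullback g.unop.left),
    fun R x => L.2.1 R (x ≫ g.unop.left),
    fun R x => L.2.2.1 R (x ≫ g.unop.left),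
    fun R x => L.2.2.2.1 R (x ≫ g.unop.left),
    fun R x => by
      have h := L.2.2.2.2.1 R (x ≫ g.unop.left)
      simpa [Subbundle.at', Subbundle.pullback, Subbundle.frob] using h,
    fun R x => by
      have h := L.2.2.2.2.2 R (x ≫ g.unop.left)
      simpa [Subbundle.at', Subbundle.pullback, Subbundle.frob] using h⟩
  map_id S := by
    refine ConcreteCategory.hom_ext _ _ fun L => ?_
    exact Subtype.ext (Prod.ext (Subbundle.pullback_id _) (Subbundle.pullback_id _))
  map_comp g h := by
    refine ConcreteCategory.hom_ext _ _ fun L => ?_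
    exact Subtype.ext
      (Prod.ext (Subbundle.pullback_comp _ _ _) (Subbundle.pullback_comp _ _ _))

/-- The forgetful morphism `𝒴_V ⟶ OGr(d+1)`, `(𝓛_d, 𝓛_{d+1}) ↦ 𝓛_{d+1}`. -/
def forget (B : LinearMap.BilinForm (ZMod p) V) (d : ℕ) : YV B d ⟶ OGr B (d + 1) where
  app _ := ↾fun L => ⟨L.1.2, L.2.2.1⟩
  naturality _ _ _ := rfl

/-- The morphism of `𝔽_{p²}`-schemes `Y ⟶ G` induced by a morphism `α : F ⟶ F'` of functors, when
`Y` represents `F` and `G` represents `F'`. -/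
def inducedHom {F F' : (Over (base p))ᵒᵖ ⥤ Type (max 1 u)} (α : F ⟶ F') {Y G : Over (base p)}
    (hY : F.RepresentableBy Y) (hG : F'.RepresentableBy G) : Y ⟶ G :=
  hG.homEquiv.symm (α.app (op Y) (hY.homEquiv (𝟙 Y)))

/-- A symmetric form on a space of dimension `2 * m` is split if there is a totally isotropic
subspace of dimension `m`. -/
def IsSplit (B : LinearMap.BilinForm (ZMod p) V) (m : ℕ) : Prop :=
  ∃ W : Submodule (ZMod p) V, Module.finrank (ZMod p) W = m ∧ ∀ u ∈ W, ∀ v ∈ W, B u v = 0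

end

end OrthDL

-- Let `L` be totally isotropic of rank `d + 1` and let `L'` be its Frobenius twist. As `dim V = 2(d
-- + 1)`, both are their own orthogonals (`mem_of_orthogonal`), so the left kernel of the pairing `L
-- × L' → 𝒪` is `L ∩ L'`. The pairing is nonzero at every point. Otherwise `L = L'` over some
-- residue field; then the coordinates of `L` in a chart are fixed by Frobenius, and `L` descends to
-- a totally isotropic subspace of `V` of dimension `d + 1`, contradicting nonsplitness
-- (`pairIdeal_map_frobenius_eq_top`).
--
-- If some `M` of rank `d` lies in `L ∩ L'`, then `L / M` has rank one and `M` pairs to zero with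
-- `L'`, so all two by two minors of the pairing vanish (`minorIdeal_eq_bot_of_le`). Conversely,
-- once the minors vanish the pairing has rank exactly one everywhere. Then `L ∩ L'` is a direct
-- summand of rank `d` compatible with base change, and `L + L'` is a direct summand too
-- (`RankOnePair`). Moreover `M` is forced to be `L ∩ L'`. Hence `𝒴_V` is the closed subscheme of
-- `OGr(d + 1)` cut out by the minors of the universal `L` against its twist
-- (`Subbundle.exists_YV_iff`).
--
-- The Grassmannian is representable because it is a Zariski sheaf covered by affine spaces of
-- matrices (`isRepresentable_grFunctor`). Isotropy is also the vanishing of an ideal compatible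
-- with base change, so `isRepresentable_and_isClosedImmersion` treats both `OGr ⊆ Gr` and `𝒴_V →
-- OGr`.
--
-- Throughout, the index of a Grassmannian is the rank of the quotient: with `k = d + 1`, the module
-- `L` has index `k` and `M` has index `k + 1`.

universe w

namespace OrthDL

noncomputable section

/-! ### Base change of submodules of `A ⊗ M` -/

section BaseChange

variable {F : Type*} [CommRing F] {M : Type*} [AddCommGroup M] [Module F M] {k : ℕ}
  {A B C : Type w} [CommRing A] [Algebra F A] [CommRing B] [Algebra F B] [CommRing C] [Algebra F C]

variable (M) in
/-- The map `A ⊗ M → B ⊗ M` induced by an algebra homomorphism `A → B`. -/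
def bc (f : A →ₐ[F] B) : A ⊗[F] M →ₗ[F] B ⊗[F] M := f.toLinearMap.rTensor M

@[simp]
lemma bc_tmul (f : A →ₐ[F] B) (a : A) (m : M) : bc M f (a ⊗ₜ m) = f a ⊗ₜ m := rfl

@[simp]
lemma bc_smul (f : A →ₐ[F] B) (a : A) (x : A ⊗[F] M) : bc M f (a • x) = f a • bc M f x := by
  induction x with
  | zero => simp
  | tmul b m => simp [smul_tmul']
  | add x y hx hy => simp [hx, hy]

lemma bc_comp (f : A →ₐ[F] B) (g : B →ₐ[F] C) (x : A ⊗[F] M) :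
    bc M (g.comp f) x = bc M g (bc M f x) := by
  induction x with
  | zero => simp
  | tmul b m => simp
  | add x y hx hy => simp [hx, hy]

lemma span_range_bc (f : A →ₐ[F] B) : Submodule.span B (Set.range (bc M f)) = ⊤ := by
  rw [eq_top_iff]
  rintro x -
  induction x with
  | zero => simp
  | tmul b m =>
    have : b ⊗ₜ[F] m = b • bc M f (1 ⊗ₜ m) := by simp [smul_tmul']
    rw [this]
    exact Submodule.smul_mem _ _ (Submodule.subset_span ⟨_, rfl⟩)
  | add x y hx hy => exact add_mem hx hy

lemma cancelBaseChange_symm_bc [Algebra A B] [IsScalarTower F A B] (x : A ⊗[F] M) :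
    (AlgebraTensorModule.cancelBaseChange F A B B M).symm (bc M (IsScalarTower.toAlgHom F A B) x) =
      1 ⊗ₜ x := by
  induction x with
  | zero => simp
  | tmul a m =>
    rw [bc_tmul, IsScalarTower.coe_toAlgHom', AlgebraTensorModule.cancelBaseChange_symm_tmul,
      ← mul_one (algebraMap A B a), ← Algebra.smul_def, smul_tmul, smul_tmul', smul_eq_mul, mul_one]
  | add x y hx hy => simp [hx, hy, tmul_add]

lemma baseChangeMkQ_bc [Algebra A B] [IsScalarTower F A B] (N : Submodule A (A ⊗[F] M))
    (x : A ⊗[F] M) :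
    Module.Grassmannian.baseChangeMkQ B N (bc M (IsScalarTower.toAlgHom F A B) x) =
      (1 : B) ⊗ₜ[A] N.mkQ x := by
  simp only [Module.Grassmannian.baseChangeMkQ, LinearMap.comp_apply, LinearEquiv.coe_coe,
    cancelBaseChange_symm_bc, LinearMap.baseChange_tmul]

/-- Right exactness of `B ⊗ -`, transported along `B ⊗ (A ⊗ M) ≃ B ⊗ M`. It turns the quotient
description of base change into a description by generators. -/
lemma ker_baseChangeMkQ [Algebra A B] [IsScalarTower F A B] (N : Submodule A (A ⊗[F] M)) :
    LinearMap.ker (Module.Grassmannian.baseChangeMkQ B N) =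
      Submodule.span B (bc M (IsScalarTower.toAlgHom F A B) '' N) := by
  have hex : LinearMap.ker (N.mkQ.baseChange B) = LinearMap.range (N.subtype.baseChange B) := by
    have := lTensor_exact (R := A) (M := N) (N := A ⊗[F] M) (P := (A ⊗[F] M) ⧸ N) B
      (LinearMap.exact_subtype_mkQ N) (Submodule.mkQ_surjective _)
    ext x
    exact this x
  rw [Module.Grassmannian.baseChangeMkQ, LinearMap.ker_comp, hex]
  change Submodule.comap _ (N.baseChange B) = _
  rw [Submodule.baseChange_eq_span]
  apply le_antisymm
  · intro x hx
    rw [Submodule.mem_comap] at hx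
    have hx' : (AlgebraTensorModule.cancelBaseChange F A B B M)
        ((AlgebraTensorModule.cancelBaseChange F A B B M).symm x) ∈
        (Submodule.span B (N.map (TensorProduct.mk A B _ 1) : Set _)).map
          (AlgebraTensorModule.cancelBaseChange F A B B M).toLinearMap :=
      Submodule.mem_map_of_mem hx
    rw [LinearEquiv.apply_symm_apply, Submodule.map_span] at hx'
    refine Submodule.span_mono ?_ hx'
    rintro _ ⟨_, ⟨y, hy, rfl⟩, rfl⟩
    refine ⟨y, hy, ?_⟩
    change _ = AlgebraTensorModule.cancelBaseChange F A B B M (1 ⊗ₜ y)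
    rw [← cancelBaseChange_symm_bc, LinearEquiv.apply_symm_apply]
  · rw [Submodule.span_le]
    rintro _ ⟨y, hy, rfl⟩
    simp only [Submodule.comap_coe, Set.mem_preimage, LinearEquiv.coe_coe, SetLike.mem_coe,
      cancelBaseChange_symm_bc]
    exact Submodule.subset_span ⟨y, hy, rfl⟩

end BaseChange

section Map

variable {F : Type*} [CommRing F] {M : Type*} [AddCommGroup M] [Module F M] {k : ℕ}
  {A B C : Type w} [CommRing A] [Algebra F A] [CommRing B] [Algebra F B] [CommRing C] [Algebra F C]

open Module

/-- The working form of functoriality: statements about a base-changed point reduce to generators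
coming from the original submodule. -/
lemma map_toSubmodule_eq_span
    (f : A →ₐ[F] B) (N : Grassmannian A (A ⊗[F] M) k) :
    (N.map f).toSubmodule = Submodule.span B (bc M f '' N.toSubmodule) := by
  let : Algebra A B := f.toAlgebra
  let : IsScalarTower F A B :=
    IsScalarTower.of_algebraMap_eq' <| IsScalarTower.algebraMap_eq F A B
  exact ker_baseChangeMkQ N.toSubmodule

end Map

end

end OrthDL

/-! ### Comparing and gluing points of the Grassmannian -/

namespace OrthDL

noncomputable section

open Module

/-- A surjection between finite projective modules of the same rank is injective. -/
lemma injective_of_surjective_of_rankAtStalk_eq {R P Q : Type*} [CommRing R] [AddCommGroup P]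
    [Module R P] [AddCommGroup Q] [Module R Q] [Module.Finite R P] [Projective R P]
    [Module.Finite R Q] [Projective R Q] (f : P →ₗ[R] Q) (hf : Function.Surjective f)
    (h : ∀ p, rankAtStalk (R := R) P p = rankAtStalk (R := R) Q p) : Function.Injective f := by
  obtain ⟨s, hs⟩ := Module.projective_lifting_property f LinearMap.id hf
  let π : P →ₗ[R] LinearMap.ker f := LinearMap.codRestrict _ (LinearMap.id - s ∘ₗ f) fun x => by
    simpa [sub_eq_zero] using (LinearMap.congr_fun hs (f x)).symm
  have hπ : ∀ x : LinearMap.ker f, π x = x := fun x => by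
    ext
    simp [π]
  have : Module.Finite R (LinearMap.ker f) := Module.Finite.of_surjective π fun x => ⟨x, hπ x⟩
  have : Projective R (LinearMap.ker f) :=
    Projective.of_split (LinearMap.ker f).subtype π (by ext x; simp [hπ])
  let e : P ≃ₗ[R] Q × LinearMap.ker f :=
    LinearEquiv.ofBijective (f.prod π) (by
      constructor
      · rw [← LinearMap.ker_eq_bot, LinearMap.ker_prod]
        refine eq_bot_iff.mpr fun x hx => ?_
        have h2 := hπ ⟨x, hx.1⟩
        rw [show π x = 0 from hx.2] at h2
        simpa using congrArg Subtype.val h2.symm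
      · rintro ⟨q, y⟩
        have h1 : f (s q) = q := LinearMap.congr_fun hs q
        have h2 : π (s q) = 0 := by
          ext
          simp [π, h1]
        refine ⟨s q + y, ?_⟩
        simp [h1, h2, hπ])
  -- The splitting makes ranks additive, so the kernel is finite projective of rank zero.
  have h0 : rankAtStalk (R := R) (LinearMap.ker f) = 0 := by
    ext p
    have h1 := congrFun (rankAtStalk_eq_of_equiv e) p
    rw [rankAtStalk_prod, h p] at h1
    simpa using h1
  rw [rankAtStalk_eq_zero_iff_subsingleton] at h0
  rw [← LinearMap.ker_eq_bot]
  exact Submodule.eq_bot_of_subsingleton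

section

variable {F : Type*} [CommRing F] {M : Type*} [AddCommGroup M] [Module F M] {k : ℕ}
  {A B : Type w} [CommRing A] [Algebra F A] [CommRing B] [Algebra F B]

/-- The quotients are finite projective of the same rank, so the surjection between them is an
isomorphism. Equalities of points are often proved through a single inclusion for this reason. -/
lemma Grassmannian.eq_of_le {M : Type*} [AddCommGroup M] [Module A M]
    {N N' : Grassmannian A M k} (h : N.toSubmodule ≤ N'.toSubmodule) : N = N' := by
  refine Grassmannian.ext (le_antisymm h fun x hx => ?_)
  have := injective_of_surjective_of_rankAtStalk_eq (Submodule.factor h)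
    (Submodule.factor_surjective h)
    (fun p => (N.rankAtStalk_eq p).trans (N'.rankAtStalk_eq p).symm)
  rw [← Submodule.Quotient.mk_eq_zero] at hx ⊢
  exact this (by simpa using hx)

lemma bc_mem_map (f : A →ₐ[F] B) (N : Grassmannian A (A ⊗[F] M) k) {x : A ⊗[F] M}
    (hx : x ∈ N.toSubmodule) : bc M f x ∈ (N.map f).toSubmodule := by
  rw [map_toSubmodule_eq_span]
  exact Submodule.subset_span ⟨x, hx, rfl⟩

lemma bc_mem_span_iff [Algebra A B] [IsScalarTower F A B] (N : Submodule A (A ⊗[F] M))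
    (x : A ⊗[F] M) :
    bc M (IsScalarTower.toAlgHom F A B) x ∈
      Submodule.span B (bc M (IsScalarTower.toAlgHom F A B) '' N) ↔
      (1 : B) ⊗ₜ[A] N.mkQ x = 0 := by
  rw [← ker_baseChangeMkQ, LinearMap.mem_ker, baseChangeMkQ_bc]

lemma bc_mem_span_iff_of_isLocalization [Algebra A B] [IsScalarTower F A B] (S : Submonoid A)
    [IsLocalization S B] (N : Submodule A (A ⊗[F] M)) (x : A ⊗[F] M) :
    bc M (IsScalarTower.toAlgHom F A B) x ∈
      Submodule.span B (bc M (IsScalarTower.toAlgHom F A B) '' N) ↔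
      ∃ s ∈ S, s • x ∈ N := by
  rw [bc_mem_span_iff]
  have := IsLocalizedModule.eq_zero_iff S (TensorProduct.mk A B (A ⊗[F] M ⧸ N) 1) (m := N.mkQ x)
  refine this.trans ⟨?_, ?_⟩
  · rintro ⟨s, hs⟩
    refine ⟨s, s.2, ?_⟩
    rwa [← Submodule.Quotient.mk_eq_zero]
  · rintro ⟨s, hs, h⟩
    refine ⟨⟨s, hs⟩, ?_⟩
    rw [← Submodule.Quotient.mk_eq_zero] at h
    exact h

lemma exists_bc_eq_smul_of_isLocalization [Algebra A B] [IsScalarTower F A B] (S : Submonoid A)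
    [IsLocalization S B] (y : B ⊗[F] M) :
    ∃ s ∈ S, ∃ x : A ⊗[F] M, bc M (IsScalarTower.toAlgHom F A B) x = algebraMap A B s • y := by
  induction y with
  | zero => exact ⟨1, S.one_mem, 0, by simp⟩
  | tmul b m =>
    obtain ⟨⟨a, s⟩, h⟩ := IsLocalization.surj S b
    refine ⟨s, s.2, a ⊗ₜ m, ?_⟩
    simp only [bc_tmul, IsScalarTower.coe_toAlgHom', smul_tmul', smul_eq_mul]
    rw [mul_comm, h]
  | add y z hy hz =>
    obtain ⟨s, hs, x, hx⟩ := hy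
    obtain ⟨t, ht, x', hx'⟩ := hz
    refine ⟨s * t, S.mul_mem hs ht, t • x + s • x', ?_⟩
    simp only [map_add, bc_smul, hx, hx', IsScalarTower.coe_toAlgHom', map_mul, smul_smul, smul_add]
    rw [mul_comm]

/-- The canonical map to the localization away from an element. -/
abbrev awayHom (F : Type*) [CommRing F] {A : Type w} [CommRing A] [Algebra F A] (r : A) :
    A →ₐ[F] Localization.Away r :=
  IsScalarTower.toAlgHom F A (Localization.Away r)

/-- Over each `A_r`, membership means that a power of `r` multiplies `x` into `N`; powers of
generators of the unit ideal still generate it. -/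
lemma mem_of_bc_away_mem {T : Set A} (hT : Ideal.span T = ⊤) (N : Submodule A (A ⊗[F] M))
    {x : A ⊗[F] M} (h : ∀ r ∈ T, bc M (awayHom F r) x ∈
      Submodule.span (Localization.Away r) (bc M (awayHom F r) '' N)) : x ∈ N := by
  refine Submodule.mem_of_span_eq_top_of_smul_pow_mem N T hT x fun r => ?_
  obtain ⟨_, ⟨n, rfl⟩, hn⟩ :=
    (bc_mem_span_iff_of_isLocalization (Submonoid.powers r.1) N x).mp (h r r.2)
  exact ⟨n, hn⟩

lemma Grassmannian.ext_away {T : Set A} (hT : Ideal.span T = ⊤)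
    {N N' : Grassmannian A (A ⊗[F] M) k}
    (h : ∀ r ∈ T, N.map (awayHom F r) = N'.map (awayHom F r)) : N = N' := by
  refine Grassmannian.ext (le_antisymm ?_ ?_)
  · refine fun x hx => mem_of_bc_away_mem hT _ fun r hr => ?_
    rw [← map_toSubmodule_eq_span, ← h r hr]
    exact bc_mem_map _ _ hx
  · refine fun x hx => mem_of_bc_away_mem hT _ fun r hr => ?_
    rw [← map_toSubmodule_eq_span, h r hr]
    exact bc_mem_map _ _ hx

end

section Glue

variable {F : Type*} [CommRing F] {M : Type*} [AddCommGroup M] [Module F M] [Module.Finite F M]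
  {k : ℕ} {A : Type w} [CommRing A] [Algebra F A]

/-- A submodule which is locally in the Grassmannian is in the Grassmannian. -/
lemma Grassmannian.exists_of_away {T : Set A} (hT : Ideal.span T = ⊤)
    (N₀ : Submodule A (A ⊗[F] M))
    (N : ∀ r ∈ T, Grassmannian (Localization.Away r) (Localization.Away r ⊗[F] M) k)
    (h : ∀ r hr, Submodule.span (Localization.Away r) (bc M (awayHom F r) '' N₀) =
      (N r hr).toSubmodule) :
    ∃ N' : Grassmannian A (A ⊗[F] M) k, N'.toSubmodule = N₀ := by
  let e (r : A) (hr : r ∈ T) : (Localization.Away r ⊗[F] M ⧸ (N r hr).toSubmodule)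
      ≃ₗ[Localization.Away r] Localization.Away r ⊗[A] ((A ⊗[F] M) ⧸ N₀) :=
    Submodule.quotEquivOfEq _ _ (((ker_baseChangeMkQ N₀).trans (h r hr)).symm) ≪≫ₗ
      Grassmannian.baseChangeMkQEquiv N₀
  have hfin (r) (hr : r ∈ T) : Module.Finite (Localization.Away r)
      (Localization.Away r ⊗[A] ((A ⊗[F] M) ⧸ N₀)) := Module.Finite.equiv (e r hr)
  have hproj (r) (hr : r ∈ T) : Projective (Localization.Away r)
      (Localization.Away r ⊗[A] ((A ⊗[F] M) ⧸ N₀)) := Projective.of_equiv (e r hr)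
  -- Finite presentation and flatness of the quotient are both local on the base, and together they
  -- give projectivity.
  have hfp : FinitePresentation A ((A ⊗[F] M) ⧸ N₀) :=
    FinitePresentation.of_localizationSpan' T hT (Rₚ := fun r => Localization.Away r.1)
      (fun r => TensorProduct.mk A (Localization.Away r.1) ((A ⊗[F] M) ⧸ N₀) 1)
      fun r => by
        have := hfin r r.2
        have := hproj r r.2
        exact Module.finitePresentation_of_projective _ _
  have hflat : Flat A ((A ⊗[F] M) ⧸ N₀) :=
    Module.flat_of_isLocalized_span A ((A ⊗[F] M) ⧸ N₀) T hT
      (fun r => Localization.Away r.1 ⊗[A] ((A ⊗[F] M) ⧸ N₀))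
      (fun r => TensorProduct.mk A (Localization.Away r.1) ((A ⊗[F] M) ⧸ N₀) 1)
      fun r => by
        have := hproj r r.2
        have : Flat A (Localization.Away r.1) := IsLocalization.flat _ (Submonoid.powers r.1)
        exact Flat.trans A (Localization.Away r.1) _
  refine ⟨⟨N₀, inferInstance, Flat.projective_of_finitePresentation, fun p => ?_⟩, rfl⟩
  obtain ⟨r, hr, hrp⟩ : ∃ r ∈ T, r ∉ p.asIdeal := by
    by_contra! hc
    exact p.2.ne_top (top_le_iff.mp (hT.ge.trans (Ideal.span_le.mpr hc)))
  obtain ⟨q, rfl⟩ : p ∈ Set.range (PrimeSpectrum.comap (algebraMap A (Localization.Away r))) := by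
    rw [PrimeSpectrum.localization_away_comap_range (Localization.Away r) r]
    exact hrp
  have : Projective A ((A ⊗[F] M) ⧸ N₀) := Flat.projective_of_finitePresentation
  rw [← rankAtStalk_baseChange, ← congrFun (rankAtStalk_eq_of_equiv (e r hr)) q]
  exact (N r hr).rankAtStalk_eq q

/-- Elements of the Grassmannian can be glued along a finite cover by basic open subsets. -/
lemma Grassmannian.exists_glue (T : Finset A) (hT : Ideal.span (T : Set A) = ⊤)
    (N : ∀ r ∈ (T : Set A), Grassmannian (Localization.Away r) (Localization.Away r ⊗[F] M) k)
    (hN : ∀ r hr s hs (C : Type w) [CommRing C] [Algebra F C]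
      (g : Localization.Away r →ₐ[F] C) (h : Localization.Away s →ₐ[F] C),
      g.comp (awayHom F r) = h.comp (awayHom F s) → (N r hr).map g = (N s hs).map h) :
    ∃ N' : Grassmannian A (A ⊗[F] M) k, ∀ r hr, N'.map (awayHom F r) = N r hr := by
  -- The only candidate: the vectors whose image in every localization lies in the given submodule.
  let N₀ : Submodule A (A ⊗[F] M) :=
    { carrier := {x | ∀ r hr, bc M (awayHom F r) x ∈ (N r hr).toSubmodule}
      add_mem' := fun hx hy r hr => by
        rw [map_add]
        exact add_mem (hx r hr) (hy r hr)
      zero_mem' := fun r hr => by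
        rw [map_zero]
        exact zero_mem _
      smul_mem' := fun a x hx r hr => by
        rw [bc_smul]
        exact Submodule.smul_mem _ _ (hx r hr) }
  have key : ∀ r hr, Submodule.span (Localization.Away r) (bc M (awayHom F r) '' N₀) =
      (N r hr).toSubmodule := by
    intro r hr
    apply le_antisymm
    · rw [Submodule.span_le]
      rintro _ ⟨x, hx, rfl⟩
      exact hx r hr
    intro y hy
    obtain ⟨_, ⟨a, rfl⟩, x, hx⟩ := exists_bc_eq_smul_of_isLocalization (Submonoid.powers r) y
    -- On the overlap `C = (A_s)_r` the two given points agree, so `x` lies in `N s` up to a power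
    -- of `r`.
    have h1 : ∀ s hs, ∃ n : ℕ, r ^ n • bc M (awayHom F s) x ∈ (N s hs).toSubmodule := by
      intro s hs
      let C := Localization.Away (algebraMap A (Localization.Away s) r)
      let h : Localization.Away s →ₐ[F] C := awayHom F _
      let g' : Localization.Away r →ₐ[A] C := IsLocalization.liftAlgHom
        (M := Submonoid.powers r) (f := IsScalarTower.toAlgHom A A C) (by
          rintro ⟨_, n, rfl⟩
          rw [map_pow]
          refine IsUnit.pow n ?_
          rw [IsScalarTower.coe_toAlgHom', IsScalarTower.algebraMap_apply A (Localization.Away s) C]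
          exact IsLocalization.Away.algebraMap_isUnit (S := C)
            (algebraMap A (Localization.Away s) r))
      let g : Localization.Away r →ₐ[F] C := g'.restrictScalars F
      have hgh : g.comp (awayHom F r) = h.comp (awayHom F s) := by
        ext a
        change g' (algebraMap A _ a) = algebraMap (Localization.Away s) C (algebraMap A _ a)
        rw [g'.commutes, ← IsScalarTower.algebraMap_apply]
      have h2 : bc M h (bc M (awayHom F s) x) ∈ ((N s hs).map h).toSubmodule := by
        rw [← hN r hr s hs C g h hgh, ← bc_comp, ← hgh, bc_comp, hx, bc_smul]
        exact Submodule.smul_mem _ _ (bc_mem_map _ _ hy)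
      rw [map_toSubmodule_eq_span] at h2
      obtain ⟨_, ⟨n, rfl⟩, hn⟩ :=
        (bc_mem_span_iff_of_isLocalization (F := F) (B := C)
          (Submonoid.powers (algebraMap A (Localization.Away s) r)) _ _).mp h2
      refine ⟨n, ?_⟩
      beta_reduce at hn
      rwa [← map_pow, algebraMap_smul] at hn
    choose n hn using h1
    -- Finiteness of the cover gives one exponent valid for all `s`.
    obtain ⟨b, hb⟩ : ∃ b : ℕ, ∀ s hs, n s hs ≤ b :=
      ⟨∑ s ∈ T.attach, n s s.2, fun s hs =>
        Finset.single_le_sum (f := fun s : T => n s.1 s.2) (fun _ _ => Nat.zero_le _)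
          (Finset.mem_attach T ⟨s, hs⟩)⟩
    have h3 : r ^ b • x ∈ N₀ := by
      intro s hs
      rw [bc_smul]
      have h4 := (N s hs).toSubmodule.smul_mem
        (algebraMap A (Localization.Away s) (r ^ (b - n s hs))) (hn s hs)
      rw [algebraMap_smul, smul_smul, ← pow_add, Nat.sub_add_cancel (hb s hs)] at h4
      rw [IsScalarTower.coe_toAlgHom', algebraMap_smul]
      exact h4
    have h5 : IsUnit (algebraMap A (Localization.Away r) r) :=
      IsLocalization.Away.algebraMap_isUnit r
    have h6 : algebraMap A (Localization.Away r) r ^ (b + a) • y ∈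
        Submodule.span (Localization.Away r) (bc M (awayHom F r) '' N₀) := by
      rw [pow_add, mul_smul, ← map_pow _ r a, ← hx]
      have : bc M (awayHom F r) (r ^ b • x) ∈
        Submodule.span (Localization.Away r) (bc M (awayHom F r) '' N₀) :=
        Submodule.subset_span ⟨_, h3, rfl⟩
      rwa [bc_smul, map_pow] at this
    exact (Submodule.smul_mem_iff_of_isUnit _ (h5.pow _)).mp h6
  obtain ⟨N', hN'⟩ := Grassmannian.exists_of_away hT N₀ N key
  refine ⟨N', fun r hr => Grassmannian.ext ?_⟩
  rw [map_toSubmodule_eq_span, hN', key r hr]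

end Glue

end

end OrthDL

/-! ### Affine charts of the Grassmannian -/

namespace OrthDL

noncomputable section

open Module

section Chart

variable {F : Type*} [CommRing F] {M : Type*} [AddCommGroup M] [Module F M]
  {k m : ℕ} (b : Basis (Fin k ⊕ Fin m) F M)
  {A B : Type w} [CommRing A] [Algebra F A] [CommRing B] [Algebra F B]

/-- The projection `A ⊗ M → A ^ k` onto the span of the first `k` basis vectors with prescribed
values on the other basis vectors. -/
def chartMap (a : Fin m → Fin k → A) : A ⊗[F] M →ₗ[A] (Fin k → A) :=
  (Algebra.TensorProduct.basis A b).constr A (Sum.elim (fun i => Pi.single i 1) a)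

@[simp]
lemma chartMap_inl (a : Fin m → Fin k → A) (i : Fin k) :
    chartMap b a (1 ⊗ₜ b (Sum.inl i)) = Pi.single i 1 := by
  rw [← Algebra.TensorProduct.basis_apply, chartMap, Basis.constr_basis]
  rfl

@[simp]
lemma chartMap_inr (a : Fin m → Fin k → A) (j : Fin m) :
    chartMap b a (1 ⊗ₜ b (Sum.inr j)) = a j := by
  rw [← Algebra.TensorProduct.basis_apply, chartMap, Basis.constr_basis]
  rfl

lemma chartMap_sum (a : Fin m → Fin k → A) (c : Fin k → A) :
    chartMap b a (∑ i, c i • (1 : A) ⊗ₜ[F] b (Sum.inl i)) = c := by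
  simp only [map_sum, map_smul, chartMap_inl]
  ext j
  simp [Finset.sum_apply, Pi.single_apply]

lemma chartMap_surjective (a : Fin m → Fin k → A) : Function.Surjective (chartMap b a) :=
  fun c => ⟨_, chartMap_sum b a c⟩

lemma chartMap_bc (f : A →ₐ[F] B) (a : Fin m → Fin k → A) (x : A ⊗[F] M) (i : Fin k) :
    chartMap b (fun j i => f (a j i)) (bc M f x) i = f (chartMap b a x i) := by
  have hx : x ∈ Submodule.span A (Set.range (Algebra.TensorProduct.basis A b)) := by
    rw [Basis.span_eq]
    trivial
  induction hx using Submodule.span_induction with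
  | zero => simp
  | add x y _ _ hx hy => simp [hx, hy]
  | smul c x _ hx => simp [hx]
  | mem x h =>
    obtain ⟨l, rfl⟩ := h
    rw [Algebra.TensorProduct.basis_apply, bc_tmul, map_one]
    cases l with
    | inl l => simp [Pi.single_apply, apply_ite f]
    | inr l => simp

/-- The point of the Grassmannian given by a matrix. -/
def chart (a : Fin m → Fin k → A) : Grassmannian A (A ⊗[F] M) k where
  toSubmodule := LinearMap.ker (chartMap b a)
  finite_quotient := Module.Finite.equiv
    ((chartMap b a).quotKerEquivOfSurjective (chartMap_surjective b a)).symm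
  projective_quotient := Projective.of_equiv
    ((chartMap b a).quotKerEquivOfSurjective (chartMap_surjective b a)).symm
  rankAtStalk_eq p := by
    have : Nontrivial A := p.nontrivial
    rw [rankAtStalk_eq_of_equiv
      ((chartMap b a).quotKerEquivOfSurjective (chartMap_surjective b a)),
      rankAtStalk_eq_finrank_of_free]
    simp

lemma mem_chart {a : Fin m → Fin k → A} {x : A ⊗[F] M} :
    x ∈ (chart b a).toSubmodule ↔ chartMap b a x = 0 := Iff.rfl

lemma chart_map (f : A →ₐ[F] B) (a : Fin m → Fin k → A) :
    (chart b a).map f = chart b (fun j i => f (a j i)) := by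
  refine Grassmannian.eq_of_le ?_
  rw [map_toSubmodule_eq_span, Submodule.span_le]
  rintro _ ⟨x, hx, rfl⟩
  have hx' : chartMap b a x = 0 := hx
  change chartMap b _ _ = 0
  ext i
  rw [chartMap_bc, hx']
  simp

/-- The vectors of the submodule attached to a matrix which span it. -/
def chartVec (a : Fin m → Fin k → A) (j : Fin m) : A ⊗[F] M :=
  1 ⊗ₜ b (Sum.inr j) - ∑ i, a j i • (1 : A) ⊗ₜ[F] b (Sum.inl i)

lemma chartVec_mem (a : Fin m → Fin k → A) (j : Fin m) :
    chartVec b a j ∈ (chart b a).toSubmodule := by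
  rw [mem_chart, chartVec, map_sub, chartMap_sum, chartMap_inr, sub_self]

lemma chart_injective : Function.Injective (chart b (A := A)) := by
  intro a a' h
  ext1 j
  have h1 := chartVec_mem b a j
  rw [h, mem_chart, chartVec, map_sub, chartMap_sum, chartMap_inr, sub_eq_zero] at h1
  exact h1.symm

variable (A) in
/-- The span of the first `k` basis vectors. -/
def coordSpan : Submodule A (A ⊗[F] M) :=
  Submodule.span A (Set.range fun i : Fin k => (1 : A) ⊗ₜ[F] b (Sum.inl i))

/-- A point of the Grassmannian lies in the chart of a basis if the first `k` basis vectors span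
the quotient. -/
def InChart (N : Grassmannian A (A ⊗[F] M) k) : Prop :=
  N.toSubmodule ⊔ coordSpan b A = ⊤

/-- If the first `k` basis vectors span a quotient of rank `k`, the surjection from `A ^ k` is an
isomorphism, and the matrix lists the coordinates of the remaining basis vectors. Conversely,
subtracting the coordinates of any vector leaves an element of the kernel. -/
lemma inChart_iff {N : Grassmannian A (A ⊗[F] M) k} : InChart b N ↔ ∃ a, chart b a = N := by
  constructor
  · intro h
    let s : (Fin k → A) →ₗ[A] (A ⊗[F] M ⧸ N.toSubmodule) :=
      Fintype.linearCombination A fun i => N.toSubmodule.mkQ ((1 : A) ⊗ₜ[F] b (Sum.inl i))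
    have hs : Function.Surjective s := by
      rw [← LinearMap.range_eq_top, Fintype.range_linearCombination, Set.range_comp' N.mkQ,
        ← Submodule.map_span, ← (Submodule.map_mkQ_eq_top _ _).mpr h]
      rfl
    have hinj := injective_of_surjective_of_rankAtStalk_eq s hs fun p => by
      have : Nontrivial A := p.nontrivial
      rw [N.rankAtStalk_eq, rankAtStalk_eq_finrank_of_free]
      simp
    let e := LinearEquiv.ofBijective s ⟨hinj, hs⟩
    let a : Fin m → Fin k → A := fun j => e.symm (N.toSubmodule.mkQ (1 ⊗ₜ b (Sum.inr j)))
    have ha : chartMap b a = e.symm.toLinearMap ∘ₗ N.toSubmodule.mkQ := by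
      refine (Algebra.TensorProduct.basis A b).ext fun l => ?_
      rw [Algebra.TensorProduct.basis_apply]
      cases l with
      | inl i =>
        rw [chartMap_inl, LinearMap.comp_apply, LinearEquiv.coe_coe, LinearEquiv.eq_symm_apply]
        simp [e, s, Fintype.linearCombination_apply_single]
      | inr j => rw [chartMap_inr]; rfl
    refine ⟨a, Grassmannian.ext ?_⟩
    change LinearMap.ker (chartMap b a) = _
    rw [ha, LinearEquiv.ker_comp, Submodule.ker_mkQ]
  · rintro ⟨a, rfl⟩
    refine eq_top_iff.mpr fun x _ => ?_
    have h1 : ∑ i, chartMap b a x i • (1 : A) ⊗ₜ[F] b (Sum.inl i) ∈ coordSpan b A :=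
      Submodule.sum_mem _ fun i _ => Submodule.smul_mem _ _ (Submodule.subset_span ⟨i, rfl⟩)
    have h2 : x - ∑ i, chartMap b a x i • (1 : A) ⊗ₜ[F] b (Sum.inl i) ∈
        (chart b a).toSubmodule := by
      rw [mem_chart, map_sub, chartMap_sum, sub_self]
    rw [← sub_add_cancel x (∑ i, chartMap b a x i • (1 : A) ⊗ₜ[F] b (Sum.inl i))]
    exact Submodule.add_mem_sup h2 h1

/-- Reduces the behaviour of the chart condition under base change to that of the single submodule
`N + coordSpan`. -/
lemma map_sup_coordSpan (f : A →ₐ[F] B) (N : Grassmannian A (A ⊗[F] M) k) :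
    (N.map f).toSubmodule ⊔ coordSpan b B =
      Submodule.span B (bc M f '' ↑(N.toSubmodule ⊔ coordSpan b A)) := by
  apply le_antisymm
  · rw [map_toSubmodule_eq_span, coordSpan, ← Submodule.span_union]
    refine Submodule.span_mono ?_
    rintro _ (⟨x, hx, rfl⟩ | ⟨i, rfl⟩)
    · exact ⟨x, Submodule.mem_sup_left hx, rfl⟩
    · exact ⟨1 ⊗ₜ b (Sum.inl i), Submodule.mem_sup_right (Submodule.subset_span ⟨i, rfl⟩),
        by simp⟩
  · rw [Submodule.span_le]
    rintro _ ⟨x, hx, rfl⟩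
    obtain ⟨y, hy, z, hz, rfl⟩ := Submodule.mem_sup.mp hx
    rw [map_add]
    refine Submodule.add_mem_sup (bc_mem_map _ _ hy) ?_
    clear hx hy
    induction hz using Submodule.span_induction with
    | mem x h =>
      obtain ⟨i, rfl⟩ := h
      exact Submodule.subset_span ⟨i, by simp⟩
    | zero => simp
    | add x y _ _ hx hy =>
      rw [map_add]
      exact add_mem hx hy
    | smul a x _ hx =>
      rw [bc_smul]
      exact Submodule.smul_mem _ _ hx

lemma InChart.map (f : A →ₐ[F] B) {N : Grassmannian A (A ⊗[F] M) k} (h : InChart b N) :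
    InChart b (N.map f) := by
  rw [InChart, map_sup_coordSpan, h]
  simpa using span_range_bc f

lemma inChart_of_away {T : Set A} (hT : Ideal.span T = ⊤) {N : Grassmannian A (A ⊗[F] M) k}
    (h : ∀ r ∈ T, InChart b (N.map (awayHom F r))) : InChart b N := by
  refine eq_top_iff.mpr fun x _ => mem_of_bc_away_mem hT _ fun r hr => ?_
  rw [← map_sup_coordSpan, h r hr]
  trivial

/-- A Nakayama argument: the finite quotient by `P` dies over `K`, hence over the residue field at
the kernel of `A → K`, since a field extension is faithfully flat. That prime is thus outside the
support, which is the zero locus of the annihilator. -/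
lemma exists_smul_mem_of_span_eq_top {K : Type w} [Field K] [Algebra F K] [Module.Finite F M]
    [Algebra A K] [IsScalarTower F A K] (P : Submodule A (A ⊗[F] M))
    (h : Submodule.span K (bc M (IsScalarTower.toAlgHom F A K) '' P) = ⊤) :
    ∃ r : A, algebraMap A K r ≠ 0 ∧ ∀ x, r • x ∈ P := by
  have h1 : Subsingleton (K ⊗[A] (A ⊗[F] M ⧸ P)) := by
    have := Submodule.Quotient.subsingleton_iff.mpr ((ker_baseChangeMkQ (B := K) P).trans h)
    exact (Grassmannian.baseChangeMkQEquiv (B := K) P).symm.toEquiv.injective.subsingleton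
  have h2 : (PrimeSpectrum.comap (algebraMap A K) ⊥) ∉ support A (A ⊗[F] M ⧸ P) := by
    intro hmem
    rw [mem_support_iff_nontrivial_residueField_tensorProduct] at hmem
    set q := (PrimeSpectrum.comap (algebraMap A K) ⊥).asIdeal
    let φ : q.ResidueField →ₐ[A] K := Ideal.ResidueField.liftₐ q (Algebra.ofId A K)
      (fun x hx => hx) fun x hx => by
        have : algebraMap A K x ≠ 0 := fun h => hx h
        exact this.isUnit
    let : Algebra q.ResidueField K := φ.toRingHom.toAlgebra
    have : IsScalarTower A q.ResidueField K :=
      IsScalarTower.of_algebraMap_eq' φ.comp_algebraMap.symm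
    have h3 := (FaithfullyFlat.nontrivial_tensorProduct_iff_right q.ResidueField K
      (N := q.ResidueField ⊗[A] (A ⊗[F] M ⧸ P))).mpr hmem
    have h4 := (AlgebraTensorModule.cancelBaseChange A q.ResidueField K K
      (A ⊗[F] M ⧸ P)).symm.toEquiv.nontrivial
    exact not_subsingleton _ h1
  rw [support_eq_zeroLocus, PrimeSpectrum.mem_zeroLocus, Set.not_subset] at h2
  obtain ⟨r, hr, hr'⟩ := h2
  refine ⟨r, fun h0 => hr' ?_, fun x => ?_⟩
  · change algebraMap A K r ∈ (⊥ : Ideal K)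
    simpa using h0
  · rw [← Submodule.Quotient.mk_eq_zero]
    exact (mem_annihilator.mp hr) (Submodule.Quotient.mk x)

/-- The charts are open. -/
lemma exists_inChart_away [Module.Finite F M] {K : Type w} [Field K] [Algebra F K]
    (f : A →ₐ[F] K) (N : Grassmannian A (A ⊗[F] M) k) (h : InChart b (N.map f)) :
    ∃ r : A, f r ≠ 0 ∧ InChart b (N.map (awayHom F r)) := by
  let : Algebra A K := f.toAlgebra
  let : IsScalarTower F A K :=
    IsScalarTower.of_algebraMap_eq' <| IsScalarTower.algebraMap_eq F A K
  rw [InChart, map_sup_coordSpan] at h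
  obtain ⟨r, hr, hr'⟩ := exists_smul_mem_of_span_eq_top (K := K) _ h
  refine ⟨r, hr, ?_⟩
  rw [InChart, map_sup_coordSpan, ← top_le_iff, ← span_range_bc (awayHom F r), Submodule.span_le]
  rintro _ ⟨x, rfl⟩
  have h1 : bc M (awayHom F r) (r • x) ∈ Submodule.span (Localization.Away r)
      (bc M (awayHom F r) '' ↑(N.toSubmodule ⊔ coordSpan b A)) :=
    Submodule.subset_span ⟨_, hr' x, rfl⟩
  rw [bc_smul] at h1
  exact (Submodule.smul_mem_iff_of_isUnit _ (IsLocalization.Away.algebraMap_isUnit r)).mp h1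

end Chart

/-- Over a field, every point of the Grassmannian lies in the chart of some reordering of a given
basis. -/
lemma exists_inChart_of_field {F : Type*} [CommRing F] {M : Type*} [AddCommGroup M] [Module F M]
    {n k m : ℕ} (hn : n = k + m) (b : Basis (Fin n) F M) {K : Type w} [Field K] [Algebra F K]
    (N : Grassmannian K (K ⊗[F] M) k) :
    ∃ e : Fin n ≃ Fin k ⊕ Fin m, InChart (b.reindex e) N := by
  let v : Fin n → (K ⊗[F] M ⧸ N.toSubmodule) := fun i => N.toSubmodule.mkQ (1 ⊗ₜ b i)
  have hv : Submodule.span K (Set.range v) = ⊤ := by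
    rw [Set.range_comp' N.toSubmodule.mkQ, ← Submodule.map_span]
    have : (fun i => (1 : K) ⊗ₜ[F] b i) = Algebra.TensorProduct.basis K b := by
      ext i
      simp
    rw [this, Basis.span_eq, Submodule.map_top, Submodule.range_mkQ]
  -- A basis of the quotient is selected among the images of the given basis vectors; the reordering
  -- puts the selected vectors first.
  obtain ⟨κ, a, ha, hspan, hli⟩ := exists_linearIndependent' K v
  rw [hv] at hspan
  have : Finite κ := Finite.of_injective a ha
  have : Fintype κ := Fintype.ofFinite κ
  have hcard : Fintype.card κ = k := by
    rw [← finrank_eq_card_basis (Basis.mk hli hspan.ge)]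
    have h1 := N.rankAtStalk_eq ⊥
    rwa [rankAtStalk_eq_finrank_of_free] at h1
  let e₁ : Fin k ≃ κ := (Fintype.equivFinOfCardEq hcard).symm
  let g : Fin k → Fin n := a ∘ e₁
  have hg : Function.Injective g := ha.comp e₁.injective
  have hc : Nonempty (Fin m ≃ ((Set.range g)ᶜ : Set (Fin n))) := by
    classical
    refine ⟨(Fintype.equivFinOfCardEq ?_).symm⟩
    rw [Fintype.card_compl_set, Fintype.card_fin, Set.card_range_of_injective hg, Fintype.card_fin,
      hn, Nat.add_sub_cancel_left]
  obtain ⟨e₂⟩ := hc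
  classical
  let e : Fin k ⊕ Fin m ≃ Fin n :=
    (Equiv.sumCongr (Equiv.ofInjective g hg) e₂).trans (Equiv.Set.sumCompl (Set.range g))
  refine ⟨e.symm, ?_⟩
  have h1 : Submodule.span K (Set.range fun i : Fin k =>
      N.toSubmodule.mkQ (1 ⊗ₜ (b.reindex e.symm) (Sum.inl i))) = ⊤ := by
    rw [← hspan]
    congr 1
    rw [← e₁.surjective.range_comp]
    congr 1
    ext i
    simp [e, v, g]
  rw [Set.range_comp' N.toSubmodule.mkQ, ← Submodule.map_span] at h1
  exact (Submodule.map_mkQ_eq_top _ _).mp h1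

end

end OrthDL

/-! ### Base change of the form and self-orthogonality in half rank -/

namespace OrthDL

noncomputable section

open Module

/-- A surjection onto a projective module splits off its kernel. -/
lemma nonempty_equiv_prod_ker {R P Q : Type*} [CommRing R] [AddCommGroup P]
    [Module R P] [AddCommGroup Q] [Module R Q] [Projective R Q] (f : P →ₗ[R] Q)
    (hf : Function.Surjective f) : Nonempty (P ≃ₗ[R] Q × LinearMap.ker f) := by
  obtain ⟨s, hs⟩ := Module.projective_lifting_property f LinearMap.id hf
  let π : P →ₗ[R] LinearMap.ker f := LinearMap.codRestrict _ (LinearMap.id - s ∘ₗ f) fun x => by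
    simpa [sub_eq_zero] using (LinearMap.congr_fun hs (f x)).symm
  have hπ : ∀ x : LinearMap.ker f, π x = x := fun x => by
    ext
    simp [π]
  refine ⟨LinearEquiv.ofBijective (f.prod π) ⟨?_, ?_⟩⟩
  · rw [← LinearMap.ker_eq_bot, LinearMap.ker_prod]
    refine eq_bot_iff.mpr fun x hx => ?_
    have h2 := hπ ⟨x, hx.1⟩
    rw [show π x = 0 from hx.2] at h2
    simpa using congrArg Subtype.val h2.symm
  · rintro ⟨q, y⟩
    have h1 : f (s q) = q := LinearMap.congr_fun hs q
    have h2 : π (s q) = 0 := by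
      ext
      simp [π, h1]
    refine ⟨s q + y, ?_⟩
    simp [h1, h2, hπ]

/-- For a finitely presented module, forming the dual commutes with localization, and over the local
ring the module is free. -/
lemma rankAtStalk_dual {R P : Type*} [CommRing R] [AddCommGroup P]
    [Module R P] [Module.Finite R P] [Projective R P] (p : PrimeSpectrum R) :
    rankAtStalk (R := R) (Dual R P) p = rankAtStalk (R := R) P p := by
  have : FinitePresentation R P := finitePresentation_of_projective R P
  have : Nontrivial R := p.nontrivial
  have : Module.Free (Localization.AtPrime p.asIdeal) (LocalizedModule p.asIdeal.primeCompl P) :=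
    free_of_flat_of_isLocalRing
  have e := ((FinitePresentation.linearEquivMapExtendScalars p.asIdeal.primeCompl
    (M := P) (N := R)).extendScalarsOfIsLocalization p.asIdeal.primeCompl
    (Localization.AtPrime p.asIdeal)).finrank_eq
  rw [finrank_linearMap] at e
  refine Eq.trans e ?_
  have := congrFun (rankAtStalk_self (R := R)) p
  rw [rankAtStalk] at this
  rw [this]
  simp [rankAtStalk]

section Form

variable {F : Type*} [Field F] {V : Type*} [AddCommGroup V] [Module F V]
  (B : LinearMap.BilinForm F V) {k : ℕ}
  {A C : Type w} [CommRing A] [Algebra F A] [CommRing C] [Algebra F C]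

/-- The base change of a bilinear form. -/
local notation "⟪" x ", " y "⟫" => LinearMap.BilinForm.baseChange _ B x y

lemma baseChange_bc (f : A →ₐ[F] C) (x y : A ⊗[F] V) :
    ⟪bc V f x, bc V f y⟫ = f ⟪x, y⟫ := by
  induction x with
  | zero => simp
  | add x x' h h' => simp [h, h']
  | tmul a v =>
    induction y with
    | zero => simp
    | add x x' h h' => simp [-bc_tmul, h, h']
    | tmul a' v' => simp [LinearMap.BilinForm.baseChange_tmul]

/-- The vector is written down with the dual basis, so nondegeneracy over the field survives over
every algebra. -/
lemma baseChange_surjective [FiniteDimensional F V] (hB : B.Nondegenerate) (φ : A ⊗[F] V →ₗ[A] A) :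
    ∃ x : A ⊗[F] V, ∀ y, ⟪x, y⟫ = φ y := by
  let b := Module.finBasis F V
  refine ⟨∑ i, φ (1 ⊗ₜ b i) • (1 : A) ⊗ₜ[F] (B.dualBasis hB b i), fun y => ?_⟩
  refine LinearMap.congr_fun (f := LinearMap.BilinForm.baseChange A B _) (g := φ) ?_ y
  refine (Algebra.TensorProduct.basis A b).ext fun j => ?_
  rw [Algebra.TensorProduct.basis_apply]
  simp [LinearMap.BilinForm.baseChange_tmul, LinearMap.sum_apply,
    LinearMap.BilinForm.apply_dualBasis_left,
    Finset.sum_ite_eq]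

/-- A submodule of the scalar extension is totally isotropic. -/
def Isotropic (N : Submodule A (A ⊗[F] V)) : Prop := ∀ u ∈ N, ∀ v ∈ N, ⟪u, v⟫ = 0

variable {B}

lemma exists_section (N : Grassmannian A (A ⊗[F] V) k) :
    ∃ s : (A ⊗[F] V ⧸ N.toSubmodule) →ₗ[A] A ⊗[F] V, ∀ x, N.toSubmodule.mkQ (s x) = x := by
  obtain ⟨s, hs⟩ := Module.projective_lifting_property N.toSubmodule.mkQ LinearMap.id
    (Submodule.mkQ_surjective _)
  exact ⟨s, LinearMap.congr_fun hs⟩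

/-- Points of the Grassmannian are direct summands. -/
lemma exists_proj (N : Grassmannian A (A ⊗[F] V) k) :
    ∃ π : A ⊗[F] V →ₗ[A] A ⊗[F] V, (∀ x, π x ∈ N.toSubmodule) ∧ ∀ x ∈ N.toSubmodule, π x = x := by
  obtain ⟨s, hs⟩ := exists_section N
  refine ⟨LinearMap.id - s ∘ₗ N.toSubmodule.mkQ, fun x => ?_, fun x hx => ?_⟩
  · rw [← Submodule.Quotient.mk_eq_zero]
    have := hs (N.toSubmodule.mkQ x)
    simp only [LinearMap.sub_apply, LinearMap.id_apply, LinearMap.comp_apply,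
      Submodule.Quotient.mk_sub, sub_eq_zero]
    exact this.symm
  · have : N.toSubmodule.mkQ x = 0 := by simpa using hx
    simp [this]

/-- A totally isotropic point of the Grassmannian of half rank is its own orthogonal. -/
lemma mem_of_orthogonal [FiniteDimensional F V] (hB : B.Nondegenerate) (hV : finrank F V = 2 * k)
    {N : Grassmannian A (A ⊗[F] V) k} (hN : Isotropic B N.toSubmodule) {x : A ⊗[F] V}
    (hx : ∀ y ∈ N.toSubmodule, ⟪x, y⟫ = 0) : x ∈ N.toSubmodule := by
  obtain ⟨π, hπ, hπ'⟩ := exists_proj N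
  let π' : A ⊗[F] V →ₗ[A] N.toSubmodule := π.codRestrict _ hπ
  have hπ'' : π' ∘ₗ N.toSubmodule.subtype = LinearMap.id := by
    ext x
    simp [π', hπ' x x.2]
  have : Module.Finite A N.toSubmodule :=
    Module.Finite.of_surjective π' fun x => ⟨x, LinearMap.congr_fun hπ'' x⟩
  have : Projective A N.toSubmodule := Projective.of_split _ _ hπ''
  let α₀ : A ⊗[F] V →ₗ[A] Dual A N.toSubmodule :=
    (LinearMap.lcomp A A N.toSubmodule.subtype) ∘ₗ LinearMap.BilinForm.baseChange A B
  -- The form induces a map from the quotient by `N` to the dual of `N`. It is onto because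
  -- functionals on the summand `N` extend, and both sides have rank `k`, so it is injective; this
  -- is the claim.
  let α : (A ⊗[F] V ⧸ N.toSubmodule) →ₗ[A] Dual A N.toSubmodule :=
    N.toSubmodule.liftQ α₀ fun u hu => by
      ext v
      exact hN u hu v v.2
  have hα : Function.Surjective α := by
    intro φ
    obtain ⟨x, hx⟩ := baseChange_surjective B hB (φ ∘ₗ π')
    refine ⟨N.toSubmodule.mkQ x, ?_⟩
    ext y
    change ⟪x, (y : A ⊗[F] V)⟫ = φ y
    rw [hx, LinearMap.comp_apply, show π' y = y from LinearMap.congr_fun hπ'' y]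
  obtain ⟨e⟩ := nonempty_equiv_prod_ker N.toSubmodule.mkQ (Submodule.mkQ_surjective _)
  rw [Submodule.ker_mkQ] at e
  have hinj := injective_of_surjective_of_rankAtStalk_eq α hα fun p => by
    have : Nontrivial A := p.nontrivial
    have h1 := congrFun (rankAtStalk_eq_of_equiv (M := A ⊗[F] V)
      (N := (A ⊗[F] V ⧸ N.toSubmodule) × N.toSubmodule) e) p
    rw [rankAtStalk_prod, Pi.add_apply, N.rankAtStalk_eq, rankAtStalk_eq_finrank_of_free] at h1
    have h2 : finrank A (A ⊗[F] V) = 2 * k := by rw [finrank_baseChange, hV]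
    refine (N.rankAtStalk_eq p).trans
      (Eq.trans ?_ (rankAtStalk_dual (P := N.toSubmodule) p).symm)
    simp only [h2] at h1
    simp at h1
    omega
  rw [← Submodule.Quotient.mk_eq_zero]
  apply hinj
  rw [map_zero]
  ext y
  exact hx y y.2

lemma Isotropic.map {N : Grassmannian A (A ⊗[F] V) k} (hN : Isotropic B N.toSubmodule)
    (f : A →ₐ[F] C) : Isotropic B (N.map f).toSubmodule := by
  intro u hu v hv
  rw [map_toSubmodule_eq_span] at hu hv
  induction hu using Submodule.span_induction with
  | zero => simp
  | add x y _ _ hx hy => simp [hx, hy]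
  | smul a x _ hx => simp [hx]
  | mem u hu =>
    obtain ⟨u, hu, rfl⟩ := hu
    induction hv using Submodule.span_induction with
    | zero => simp
    | add x y _ _ hx hy => simp [hx, hy]
    | smul a x _ hx => simp [hx]
    | mem v hv =>
      obtain ⟨v, hv, rfl⟩ := hv
      rw [baseChange_bc, hN u hu v hv, map_zero]

end Form

end

end OrthDL

/-! ### Pairings of rank one between totally isotropic submodules -/

namespace OrthDL

noncomputable section

open Module

section Form

variable {F : Type*} [Field F] {V : Type*} [AddCommGroup V] [Module F V]
  (B : LinearMap.BilinForm F V) {k k' : ℕ}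
  {A C : Type w} [CommRing A] [Algebra F A] [CommRing C] [Algebra F C]

/-- The base change of a bilinear form. -/
local notation "⟪" x ", " y "⟫" => LinearMap.BilinForm.baseChange _ B x y

/-- The ideal generated by the values of the form on a pair of submodules. -/
def pairIdeal (N N' : Submodule A (A ⊗[F] V)) : Ideal A :=
  Ideal.span {a | ∃ u ∈ N, ∃ w ∈ N', a = ⟪u, w⟫}

/-- The ideal generated by the two by two minors of the pairing of two submodules. -/
def minorIdeal (N N' : Submodule A (A ⊗[F] V)) : Ideal A :=
  Ideal.span {a | ∃ u₁ ∈ N, ∃ u₂ ∈ N, ∃ w₁ ∈ N', ∃ w₂ ∈ N',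
    a = ⟪u₁, w₁⟫ * ⟪u₂, w₂⟫ - ⟪u₁, w₂⟫ * ⟪u₂, w₁⟫}

variable {B}

lemma pairIdeal_eq_bot_iff {N N' : Submodule A (A ⊗[F] V)} :
    pairIdeal B N N' = ⊥ ↔ ∀ u ∈ N, ∀ w ∈ N', ⟪u, w⟫ = 0 := by
  rw [pairIdeal, Ideal.span_eq_bot]
  constructor
  · exact fun h u hu w hw => h _ ⟨u, hu, w, hw, rfl⟩
  · rintro h _ ⟨u, hu, w, hw, rfl⟩
    exact h u hu w hw

lemma minorIdeal_eq_bot_iff {N N' : Submodule A (A ⊗[F] V)} :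
    minorIdeal B N N' = ⊥ ↔ ∀ u₁ ∈ N, ∀ u₂ ∈ N, ∀ w₁ ∈ N', ∀ w₂ ∈ N',
      ⟪u₁, w₁⟫ * ⟪u₂, w₂⟫ = ⟪u₁, w₂⟫ * ⟪u₂, w₁⟫ := by
  rw [minorIdeal, Ideal.span_eq_bot]
  constructor
  · exact fun h u₁ hu₁ u₂ hu₂ w₁ hw₁ w₂ hw₂ =>
      sub_eq_zero.mp (h _ ⟨u₁, hu₁, u₂, hu₂, w₁, hw₁, w₂, hw₂, rfl⟩)
  · rintro h _ ⟨u₁, hu₁, u₂, hu₂, w₁, hw₁, w₂, hw₂, rfl⟩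
    exact sub_eq_zero.mpr (h u₁ hu₁ u₂ hu₂ w₁ hw₁ w₂ hw₂)

/-- Linear extension from generators in one variable. Keeping `ψ` separate from its linear version
`φ` allows the multilinear expressions below to be treated one argument at a time. -/
lemma apply_mem_of_mem_map (f : A →ₐ[F] C) {N : Grassmannian A (A ⊗[F] V) k} (I : Ideal C)
    {ψ : C ⊗[F] V → C} (φ : C ⊗[F] V →ₗ[C] C) (hφ : ∀ y, φ y = ψ y)
    (h : ∀ x ∈ N.toSubmodule, ψ (bc V f x) ∈ I) {y : C ⊗[F] V}
    (hy : y ∈ (N.map f).toSubmodule) : ψ y ∈ I := by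
  rw [map_toSubmodule_eq_span] at hy
  rw [← hφ]
  refine (Submodule.span_le (p := Submodule.comap φ I)).mpr ?_ hy
  rintro _ ⟨x, hx, rfl⟩
  simpa [hφ] using h x hx

lemma pairIdeal_map (f : A →ₐ[F] C) (N : Grassmannian A (A ⊗[F] V) k)
    (N' : Grassmannian A (A ⊗[F] V) k') :
    pairIdeal B (N.map f).toSubmodule (N'.map f).toSubmodule =
      (pairIdeal B N.toSubmodule N'.toSubmodule).map f := by
  apply le_antisymm
  · refine Ideal.span_le.mpr ?_
    rintro _ ⟨u, hu, w, hw, rfl⟩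
    refine apply_mem_of_mem_map f _ ((LinearMap.BilinForm.baseChange C B).flip w) (fun _ => rfl)
      (fun x hx => ?_) hu
    refine apply_mem_of_mem_map f _ (LinearMap.BilinForm.baseChange C B (bc V f x))
      (fun _ => rfl) (fun y hy => ?_) hw
    rw [baseChange_bc]
    exact Ideal.mem_map_of_mem _ (Ideal.subset_span ⟨x, hx, y, hy, rfl⟩)
  · rw [pairIdeal, Ideal.map_span]
    refine Ideal.span_le.mpr ?_
    rintro _ ⟨_, ⟨u, hu, w, hw, rfl⟩, rfl⟩
    refine Ideal.subset_span ⟨_, bc_mem_map f _ hu, _, bc_mem_map f _ hw, ?_⟩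
    exact (baseChange_bc B f u w).symm

/-- A minor is linear in each of its four arguments, so each can be replaced in turn by a vector
coming from `A`. This compatibility is what makes the minors define a closed subscheme. -/
lemma minorIdeal_map (f : A →ₐ[F] C) (N : Grassmannian A (A ⊗[F] V) k)
    (N' : Grassmannian A (A ⊗[F] V) k') :
    minorIdeal B (N.map f).toSubmodule (N'.map f).toSubmodule =
      (minorIdeal B N.toSubmodule N'.toSubmodule).map f := by
  let β := LinearMap.BilinForm.baseChange C B
  apply le_antisymm
  · refine Ideal.span_le.mpr ?_
    rintro _ ⟨u₁, hu₁, u₂, hu₂, w₁, hw₁, w₂, hw₂, rfl⟩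
    refine apply_mem_of_mem_map (ψ := fun u₁ => β u₁ w₁ * β u₂ w₂ - β u₁ w₂ * β u₂ w₁) f _
      (β u₂ w₂ • β.flip w₁ - β u₂ w₁ • β.flip w₂) (fun y => by simp; ring) (fun x₁ hx₁ => ?_) hu₁
    refine apply_mem_of_mem_map
      (ψ := fun u₂ => β (bc V f x₁) w₁ * β u₂ w₂ - β (bc V f x₁) w₂ * β u₂ w₁) f _
      (β (bc V f x₁) w₁ • β.flip w₂ - β (bc V f x₁) w₂ • β.flip w₁) (fun y => by simp)
      (fun x₂ hx₂ => ?_) hu₂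
    refine apply_mem_of_mem_map
      (ψ := fun w₁ => β (bc V f x₁) w₁ * β (bc V f x₂) w₂ - β (bc V f x₁) w₂ * β (bc V f x₂) w₁) f _
      (β (bc V f x₂) w₂ • β (bc V f x₁) - β (bc V f x₁) w₂ • β (bc V f x₂))
      (fun y => by simp; ring) (fun y₁ hy₁ => ?_) hw₁
    refine apply_mem_of_mem_map
      (ψ := fun w₂ => β (bc V f x₁) (bc V f y₁) * β (bc V f x₂) w₂ -
        β (bc V f x₁) w₂ * β (bc V f x₂) (bc V f y₁)) f _
      (β (bc V f x₁) (bc V f y₁) • β (bc V f x₂) - β (bc V f x₂) (bc V f y₁) • β (bc V f x₁))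
      (fun y => by simp; ring) (fun y₂ hy₂ => ?_) hw₂
    have h := Ideal.mem_map_of_mem f (Ideal.subset_span
      ⟨x₁, hx₁, x₂, hx₂, y₁, hy₁, y₂, hy₂, rfl⟩ : _ ∈ minorIdeal B N.toSubmodule N'.toSubmodule)
    rw [map_sub, map_mul, map_mul] at h
    simp only [← baseChange_bc] at h
    exact h
  · rw [minorIdeal, Ideal.map_span]
    refine Ideal.span_le.mpr ?_
    rintro _ ⟨_, ⟨u₁, hu₁, u₂, hu₂, w₁, hw₁, w₂, hw₂, rfl⟩, rfl⟩
    refine Ideal.subset_span ⟨_, bc_mem_map f _ hu₁, _, bc_mem_map f _ hu₂,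
      _, bc_mem_map f _ hw₁, _, bc_mem_map f _ hw₂, ?_⟩
    simp only [baseChange_bc]
    exact (map_sub f _ _).trans (congrArg₂ _ (map_mul f _ _) (map_mul f _ _))

/-- If the pairing of two submodules generates the unit ideal, then `1` is a sum of its values. -/
lemma exists_sum_eq_one {N N' : Submodule A (A ⊗[F] V)} (h : pairIdeal B N N' = ⊤) :
    ∃ (n : ℕ) (u w : Fin n → A ⊗[F] V), (∀ i, u i ∈ N) ∧ (∀ i, w i ∈ N') ∧
      ∑ i, ⟪u i, w i⟫ = 1 := by
  have h1 : (1 : A) ∈ pairIdeal B N N' := h ▸ Submodule.mem_top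
  obtain ⟨n, c, g, hg⟩ := (Submodule.mem_span_set' (R := A)).mp h1
  choose u hu w hw hgw using fun i => (g i).2
  refine ⟨n, fun i => c i • u i, w, fun i => N.smul_mem _ (hu i), hw, ?_⟩
  rw [← hg]
  simp [hgw]

/-- Two totally isotropic submodules whose pairing has rank one at every point. -/
structure RankOnePair (B : LinearMap.BilinForm F V) (N N' : Grassmannian A (A ⊗[F] V) k) :
    Prop where
  left : Isotropic B N.toSubmodule
  right : Isotropic B N'.toSubmodule
  pair : pairIdeal B N.toSubmodule N'.toSubmodule = ⊤
  minor : minorIdeal B N.toSubmodule N'.toSubmodule = ⊥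

namespace RankOnePair

variable {N N' : Grassmannian A (A ⊗[F] V) k}

lemma map (h : RankOnePair B N N') (f : A →ₐ[F] C) : RankOnePair B (N.map f) (N'.map f) where
  left := h.left.map f
  right := h.right.map f
  pair := by rw [pairIdeal_map, h.pair, Ideal.map_top]
  minor := by rw [minorIdeal_map, h.minor, Ideal.map_bot]

/-- Against `y` in `N'`, the minor relation rewrites `⟪x, w i⟫ * ⟪u i, y⟫` as `⟪x, y⟫ * ⟪u i, w i⟫`,
and the sum over `i` is `⟪x, y⟫`. So the difference is orthogonal to `N'`, hence lies in it. The
correction `x ↦ ∑ ⟪x, w i⟫ • u i` is the explicit splitting behind all the following results. -/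
lemma sub_sum_mem_inf [FiniteDimensional F V] (h : RankOnePair B N N') (hB : B.Nondegenerate)
    (hV : finrank F V = 2 * k) {n : ℕ} {u w : Fin n → A ⊗[F] V} (hu : ∀ i, u i ∈ N.toSubmodule)
    (hw : ∀ i, w i ∈ N'.toSubmodule) (huw : ∑ i, ⟪u i, w i⟫ = 1) {x : A ⊗[F] V}
    (hx : x ∈ N.toSubmodule) :
    x - ∑ i, ⟪x, w i⟫ • u i ∈ N.toSubmodule ⊓ N'.toSubmodule := by
  refine ⟨sub_mem hx (Submodule.sum_mem _ fun i _ => Submodule.smul_mem _ _ (hu i)), ?_⟩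
  refine mem_of_orthogonal hB hV h.right fun y hy => ?_
  have h₂ := minorIdeal_eq_bot_iff.mp h.minor
  simp only [map_sub, LinearMap.sub_apply, map_sum, LinearMap.sum_apply, map_smul,
    LinearMap.smul_apply, smul_eq_mul]
  rw [Finset.sum_congr rfl fun i _ => h₂ x hx (u i) (hu i) (w i) (hw i) y hy, ← Finset.mul_sum,
    huw, mul_one, sub_self]

lemma sum_eq_zero (h : RankOnePair B N N') {n : ℕ} {u w : Fin n → A ⊗[F] V}
    (hw : ∀ i, w i ∈ N'.toSubmodule) {x : A ⊗[F] V} (hx : x ∈ N'.toSubmodule) :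
    ∑ i, ⟪x, w i⟫ • u i = 0 :=
  Finset.sum_eq_zero fun i _ => by rw [h.right x hx _ (hw i), zero_smul]

/-- With `e` the correction map and `π` a projection onto `N'`, the map `e + π (1 - e)` is a
projection onto `N + N'`: it fixes `N'` because `e` kills `N'`, and it fixes `N` because `y - e y`
lies in `N'` for `y` in `N`. -/
lemma exists_isCompl_sup [FiniteDimensional F V] (h : RankOnePair B N N') (hB : B.Nondegenerate)
    (hV : finrank F V = 2 * k) :
    ∃ P : Submodule A (A ⊗[F] V), IsCompl (N.toSubmodule ⊔ N'.toSubmodule) P := by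
  obtain ⟨n, u, w, hu, hw, huw⟩ := exists_sum_eq_one h.pair
  obtain ⟨π, hπ, hπ'⟩ := exists_proj N'
  let e : A ⊗[F] V →ₗ[A] A ⊗[F] V :=
    ∑ i, ((LinearMap.BilinForm.baseChange A B).flip (w i)).smulRight (u i)
  have he : ∀ x, e x = ∑ i, ⟪x, w i⟫ • u i := fun x => by simp [e]
  have heN : ∀ x, e x ∈ N.toSubmodule := fun x => by
    rw [he]
    exact Submodule.sum_mem _ fun i _ => Submodule.smul_mem _ _ (hu i)
  let g : A ⊗[F] V →ₗ[A] ↥(N.toSubmodule ⊔ N'.toSubmodule) :=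
    (e + π ∘ₗ (LinearMap.id - e)).codRestrict _ fun x => by
      simpa using Submodule.add_mem_sup (heN x) (hπ (x - e x))
  refine ⟨LinearMap.ker g, LinearMap.isCompl_of_proj fun x => ?_⟩
  ext
  change e x + π (x - e x) = x
  obtain ⟨x, hx⟩ := x
  obtain ⟨y, hy, z, hz, rfl⟩ := Submodule.mem_sup.mp hx
  have hez : e z = 0 := by rw [he, h.sum_eq_zero hw hz]
  have hey : y - e y ∈ N'.toSubmodule := by
    rw [he]
    exact (h.sub_sum_mem_inf hB hV hu hw huw hy).2
  simp only [map_add, hez, add_zero]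
  rw [add_sub_right_comm, map_add, hπ' z hz, hπ' _ hey]
  abel

lemma projective_quotient_inf [FiniteDimensional F V] (h : RankOnePair B N N')
    (hB : B.Nondegenerate) (hV : finrank F V = 2 * k) :
    Projective A ((A ⊗[F] V) ⧸ (N.toSubmodule ⊓ N'.toSubmodule)) := by
  obtain ⟨n, u, w, hu, hw, huw⟩ := exists_sum_eq_one h.pair
  obtain ⟨π, hπ, hπ'⟩ := exists_proj N
  let e : A ⊗[F] V →ₗ[A] A ⊗[F] V :=
    ∑ i, ((LinearMap.BilinForm.baseChange A B).flip (w i)).smulRight (u i)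
  have he : ∀ x, e x = ∑ i, ⟪x, w i⟫ • u i := fun x => by simp [e]
  -- Project to `N`, then subtract the correction: this is a projection onto the intersection, so
  -- the quotient is a summand of a free module.
  let g : A ⊗[F] V →ₗ[A] A ⊗[F] V := π - e ∘ₗ π
  have hg : ∀ x, g x ∈ N.toSubmodule ⊓ N'.toSubmodule := fun x => by
    have := h.sub_sum_mem_inf hB hV hu hw huw (hπ x)
    rwa [← he] at this
  have hg' : ∀ x ∈ N.toSubmodule ⊓ N'.toSubmodule, g x = x := fun x hx => by
    change π x - e (π x) = x
    rw [hπ' x hx.1, he, h.sum_eq_zero hw hx.2, sub_zero]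
  refine Projective.of_split (P := (A ⊗[F] V) ⧸ (N.toSubmodule ⊓ N'.toSubmodule))
    ((N.toSubmodule ⊓ N'.toSubmodule).liftQ (LinearMap.id - g) fun x hx => by
      simp [hg' x hx]) (N.toSubmodule ⊓ N'.toSubmodule).mkQ ?_
  refine LinearMap.ext fun q => ?_
  obtain ⟨x, rfl⟩ := (N.toSubmodule ⊓ N'.toSubmodule).mkQ_surjective q
  have : (N.toSubmodule ⊓ N'.toSubmodule).mkQ (g x) = 0 := by
    rw [Submodule.mkQ_apply, Submodule.Quotient.mk_eq_zero]
    exact hg x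
  change (N.toSubmodule ⊓ N'.toSubmodule).mkQ (x - g x) = _
  rw [map_sub, this, sub_zero]
  rfl

/-- Intersections need not commute with base change; here the correction formula does. It sends
generators of the base change of `N` to images of elements of the intersection, and it changes
nothing on vectors also lying in the base change of `N'`. -/
lemma span_bc_inf [FiniteDimensional F V] (h : RankOnePair B N N') (hB : B.Nondegenerate)
    (hV : finrank F V = 2 * k) (f : A →ₐ[F] C) :
    Submodule.span C (bc V f '' ↑(N.toSubmodule ⊓ N'.toSubmodule)) =
      (N.map f).toSubmodule ⊓ (N'.map f).toSubmodule := by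
  apply le_antisymm
  · rw [Submodule.span_le]
    rintro _ ⟨x, hx, rfl⟩
    exact ⟨bc_mem_map f _ hx.1, bc_mem_map f _ hx.2⟩
  obtain ⟨n, u, w, hu, hw, huw⟩ := exists_sum_eq_one h.pair
  have key : ∀ y ∈ (N.map f).toSubmodule, y - ∑ i, ⟪y, bc V f (w i)⟫ • bc V f (u i) ∈
      Submodule.span C (bc V f '' ↑(N.toSubmodule ⊓ N'.toSubmodule)) := by
    intro y hy
    rw [map_toSubmodule_eq_span] at hy
    let e : C ⊗[F] V →ₗ[C] C ⊗[F] V :=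
      ∑ i, ((LinearMap.BilinForm.baseChange C B).flip (bc V f (w i))).smulRight (bc V f (u i))
    let g : C ⊗[F] V →ₗ[C] C ⊗[F] V := LinearMap.id - e
    have he : ∀ x, g x = x - ∑ i, ⟪x, bc V f (w i)⟫ • bc V f (u i) :=
      fun x => by simp [g, e]
    rw [← he]
    refine (Submodule.span_le (p := Submodule.comap g (Submodule.span C
      (bc V f '' ↑(N.toSubmodule ⊓ N'.toSubmodule))))).mpr ?_ hy
    rintro _ ⟨x, hx, rfl⟩
    refine Submodule.subset_span ⟨_, h.sub_sum_mem_inf hB hV hu hw huw hx, ?_⟩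
    rw [he, map_sub, map_sum]
    simp only [bc_smul, baseChange_bc]
  intro y hy
  have h1 := key y hy.1
  rwa [(h.map f).sum_eq_zero (fun i => bc_mem_map f _ (hw i)) hy.2, sub_zero] at h1

/-- For `u`, `w` with nonzero pairing, the single functional `⟪·, w⟫` cuts the intersection out of
`N`, because the minors involving `u` and `w` vanish. -/
lemma finrank_quotient_inf [FiniteDimensional F V] {K : Type w} [Field K] [Algebra F K]
    {N N' : Grassmannian K (K ⊗[F] V) k} (h : RankOnePair B N N') (hB : B.Nondegenerate)
    (hV : finrank F V = 2 * k) :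
    finrank K ((K ⊗[F] V) ⧸ (N.toSubmodule ⊓ N'.toSubmodule)) = k + 1 := by
  obtain ⟨u, hu, w, hw, huw⟩ : ∃ u ∈ N.toSubmodule, ∃ w ∈ N'.toSubmodule, ⟪u, w⟫ ≠ 0 := by
    by_contra! hc
    have := h.pair
    rw [pairIdeal_eq_bot_iff.mpr hc] at this
    exact bot_ne_top this
  let g : K ⊗[F] V →ₗ[K] (K ⊗[F] V ⧸ N.toSubmodule) × K :=
    N.toSubmodule.mkQ.prod ((LinearMap.BilinForm.baseChange K B).flip w)
  have hker : LinearMap.ker g = N.toSubmodule ⊓ N'.toSubmodule := by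
    ext x
    rw [LinearMap.ker_prod, Submodule.mem_inf, Submodule.mem_inf, Submodule.ker_mkQ,
      LinearMap.mem_ker]
    refine and_congr_right fun hx => ⟨fun hxw => ?_, fun hx' => h.right x hx' w hw⟩
    refine mem_of_orthogonal hB hV h.right fun y hy => ?_
    have := minorIdeal_eq_bot_iff.mp h.minor u hu x hx w hw y hy
    rw [show ⟪x, w⟫ = 0 from hxw, mul_zero] at this
    exact (mul_eq_zero.mp this).resolve_left huw
  have hsurj : Function.Surjective g := by
    rintro ⟨q, c⟩
    obtain ⟨v, rfl⟩ := N.toSubmodule.mkQ_surjective q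
    refine ⟨v + ((c - ⟪v, w⟫) / ⟪u, w⟫) • u, ?_⟩
    have hu' : N.toSubmodule.mkQ u = 0 := by simpa using hu
    refine Prod.ext (Eq.trans (b := N.toSubmodule.mkQ (v + ((c - ⟪v, w⟫) / ⟪u, w⟫) • u)) rfl ?_)
      (Eq.trans (b := ⟪v + ((c - ⟪v, w⟫) / ⟪u, w⟫) • u, w⟫) rfl ?_)
    · rw [map_add, map_smul, hu', smul_zero, add_zero]
    · rw [map_add, map_smul, LinearMap.add_apply, LinearMap.smul_apply, smul_eq_mul,
        div_mul_cancel₀ _ huw, add_sub_cancel]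
  rw [← hker, (g.quotKerEquivOfSurjective hsurj).finrank_eq, finrank_prod, finrank_self]
  have h1 := N.rankAtStalk_eq ⊥
  rw [rankAtStalk_eq_finrank_of_free] at h1
  simpa using h1

/-- The intersection of two totally isotropic submodules whose pairing has rank one. -/
def inf [FiniteDimensional F V] (h : RankOnePair B N N') (hB : B.Nondegenerate)
    (hV : finrank F V = 2 * k) : Grassmannian A (A ⊗[F] V) (k + 1) where
  toSubmodule := N.toSubmodule ⊓ N'.toSubmodule
  finite_quotient := inferInstance
  projective_quotient := h.projective_quotient_inf hB hV
  rankAtStalk_eq p := by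
    have := h.projective_quotient_inf hB hV
    -- The rank at a prime is the dimension over its residue field, where the intersection may be
    -- computed after base change.
    have h1 := (h.map (IsScalarTower.toAlgHom F A p.asIdeal.ResidueField)).finrank_quotient_inf
      hB hV
    rw [← h.span_bc_inf hB hV, ← ker_baseChangeMkQ] at h1
    rw [rankAtStalk_eq, ← h1]
    exact (Grassmannian.baseChangeMkQEquiv (B := p.asIdeal.ResidueField)
      (N.toSubmodule ⊓ N'.toSubmodule)).finrank_eq.symm

lemma inf_map [FiniteDimensional F V] (h : RankOnePair B N N') (hB : B.Nondegenerate)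
    (hV : finrank F V = 2 * k) (f : A →ₐ[F] C) :
    (h.inf hB hV).map f = (h.map f).inf hB hV :=
  Grassmannian.ext ((map_toSubmodule_eq_span f _).trans (h.span_bc_inf hB hV f))

end RankOnePair

/-- Two totally isotropic submodules which share a submodule of corank one have a pairing of rank
at most one. -/
lemma minor_eq_of_isLocalRing [IsLocalRing A] {N N' : Grassmannian A (A ⊗[F] V) k}
    (hN' : Isotropic B N'.toSubmodule)
    {L : Grassmannian A (A ⊗[F] V) (k + 1)} (hL : L.toSubmodule ≤ N.toSubmodule)
    (hL' : L.toSubmodule ≤ N'.toSubmodule) {u₁ u₂ w₁ w₂ : A ⊗[F] V} (hu₁ : u₁ ∈ N.toSubmodule)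
    (hu₂ : u₂ ∈ N.toSubmodule) (hw₁ : w₁ ∈ N'.toSubmodule) (hw₂ : w₂ ∈ N'.toSubmodule) :
    ⟪u₁, w₁⟫ * ⟪u₂, w₂⟫ = ⟪u₁, w₂⟫ * ⟪u₂, w₁⟫ := by
  obtain ⟨e⟩ := nonempty_equiv_prod_ker (Submodule.factor hL) (Submodule.factor_surjective hL)
  have hfin : Module.Finite A (LinearMap.ker (Submodule.factor hL)) :=
    Module.Finite.of_surjective (LinearMap.snd A ((A ⊗[F] V) ⧸ N.toSubmodule)
        (LinearMap.ker (Submodule.factor hL)) ∘ₗ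
        e.toLinearMap)
      (Prod.snd_surjective.comp e.surjective)
  have hproj : Projective A (LinearMap.ker (Submodule.factor hL)) :=
    Projective.of_split (P := LinearMap.ker (Submodule.factor hL))
      (e.symm.toLinearMap ∘ₗ LinearMap.inr A ((A ⊗[F] V) ⧸ N.toSubmodule) _)
      (LinearMap.snd A ((A ⊗[F] V) ⧸ N.toSubmodule)
        (LinearMap.ker (Submodule.factor hL)) ∘ₗ
        e.toLinearMap)
      (by ext x; simp)
  have hfree : Module.Free A (LinearMap.ker (Submodule.factor hL)) := free_of_flat_of_isLocalRing
  have hrank : finrank A (LinearMap.ker (Submodule.factor hL)) = 1 := by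
    have h1 := congrFun (rankAtStalk_eq_of_equiv (M := (A ⊗[F] V) ⧸ L.toSubmodule)
      (N := ((A ⊗[F] V) ⧸ N.toSubmodule) × LinearMap.ker (Submodule.factor hL)) e)
      (IsLocalRing.closedPoint A)
    rw [rankAtStalk_prod, Pi.add_apply, N.rankAtStalk_eq, L.rankAtStalk_eq,
      rankAtStalk_eq_finrank_of_free] at h1
    simp at h1
    omega
  let bs := Module.finBasisOfFinrankEq A _ hrank
  obtain ⟨g, hg⟩ := L.toSubmodule.mkQ_surjective (bs 0)
  -- The kernel of the map of quotients is `N / L`, free of rank one over the local ring, so `N` is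
  -- generated by `g` and `L`. As `L` pairs to zero with `N'`, all values are multiples of values at
  -- `g`.
  have hcyc : ∀ u ∈ N.toSubmodule, ∃ a : A, ∃ l ∈ L.toSubmodule, u = a • g + l := by
    intro u hu
    have hmem : L.toSubmodule.mkQ u ∈ LinearMap.ker (Submodule.factor hL) := by
      simpa using hu
    have h1 := bs.sum_repr ⟨_, hmem⟩
    rw [Fin.sum_univ_one] at h1
    refine ⟨bs.repr ⟨_, hmem⟩ 0, u - bs.repr ⟨_, hmem⟩ 0 • g, ?_, by abel⟩
    have h2 := congrArg Subtype.val h1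
    simp only [Submodule.coe_smul, ← hg] at h2
    rw [← Submodule.Quotient.mk_eq_zero, Submodule.Quotient.mk_sub, Submodule.Quotient.mk_smul]
    exact sub_eq_zero.mpr h2.symm
  obtain ⟨a₁, l₁, hl₁, rfl⟩ := hcyc u₁ hu₁
  obtain ⟨a₂, l₂, hl₂, rfl⟩ := hcyc u₂ hu₂
  simp only [map_add, map_smul, LinearMap.add_apply, LinearMap.smul_apply, smul_eq_mul,
    hN' l₁ (hL' hl₁) _ hw₁, hN' l₁ (hL' hl₁) _ hw₂, hN' l₂ (hL' hl₂) _ hw₁,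
    hN' l₂ (hL' hl₂) _ hw₂]
  ring

lemma minorIdeal_eq_bot_of_le {N N' : Grassmannian A (A ⊗[F] V) k}
    (hN' : Isotropic B N'.toSubmodule)
    {L : Grassmannian A (A ⊗[F] V) (k + 1)} (hL : L.toSubmodule ≤ N.toSubmodule)
    (hL' : L.toSubmodule ≤ N'.toSubmodule) :
    minorIdeal B N.toSubmodule N'.toSubmodule = ⊥ := by
  rw [minorIdeal_eq_bot_iff]
  intro u₁ hu₁ u₂ hu₂ w₁ hw₁ w₂ hw₂
  refine Module.eq_of_localization_maximal (fun P _ => Localization.AtPrime P)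
    (fun P _ => Algebra.linearMap A (Localization.AtPrime P)) _ _ fun P hP => ?_
  let f := IsScalarTower.toAlgHom F A (Localization.AtPrime P)
  have hle : ∀ {M : Grassmannian A (A ⊗[F] V) k}, L.toSubmodule ≤ M.toSubmodule →
      (L.map f).toSubmodule ≤ (M.map f).toSubmodule := fun h => by
    rw [map_toSubmodule_eq_span, map_toSubmodule_eq_span]
    exact Submodule.span_mono (Set.image_mono h)
  have := minor_eq_of_isLocalRing (hN'.map f) (hle hL) (hle hL')
    (bc_mem_map f _ hu₁) (bc_mem_map f _ hu₂) (bc_mem_map f _ hw₁) (bc_mem_map f _ hw₂)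
  simp only [baseChange_bc] at this
  change f _ = f _
  exact (map_mul f _ _).trans (this.trans (map_mul f _ _).symm)

end Form

end

end OrthDL

/-! ### Frobenius descent and nonsplitness -/

namespace OrthDL

noncomputable section

open Module

/-- A totally isotropic point of the Grassmannian over the base field is a totally isotropic
subspace. -/
lemma exists_isotropic_of_grassmannian {F : Type w} [Field F] {V : Type*} [AddCommGroup V]
    [Module F V]
    [FiniteDimensional F V] {B : LinearMap.BilinForm F V} {k : ℕ} (hV : finrank F V = 2 * k)
    {N : Grassmannian F (F ⊗[F] V) k} (hN : Isotropic B N.toSubmodule) :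
    ∃ W : Submodule F V, finrank F W = k ∧ ∀ u ∈ W, ∀ v ∈ W, B u v = 0 := by
  refine ⟨N.toSubmodule.map (TensorProduct.lid F V).toLinearMap, ?_, ?_⟩
  · rw [LinearEquiv.finrank_map_eq]
    have h1 := N.rankAtStalk_eq ⊥
    rw [rankAtStalk_eq_finrank_of_free] at h1
    have h2 := N.toSubmodule.finrank_quotient_add_finrank
    rw [(TensorProduct.lid F V).finrank_eq, hV] at h2
    have h3 : finrank F (F ⊗[F] V ⧸ N.toSubmodule) = k := by simpa using h1
    omega
  · rintro _ ⟨u, hu, rfl⟩ _ ⟨v, hv, rfl⟩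
    have h := hN u hu v hv
    obtain ⟨u, rfl⟩ := (TensorProduct.lid F V).symm.surjective u
    obtain ⟨v, rfl⟩ := (TensorProduct.lid F V).symm.surjective v
    simpa using h

section Frobenius

variable {F : Type w} [Field F] [Fintype F] {V : Type*} [AddCommGroup V] [Module F V]
  {k : ℕ} {A C : Type w} [CommRing A] [Algebra F A] [CommRing C] [Algebra F C]

/-- The elements of `F` already account for all the roots that `X ^ q - X` can have in `K`, where
`q` is the cardinality of `F`. -/
lemma mem_range_algebraMap_of_pow_card_eq {K : Type*} [Field K] [Algebra F K] {x : K}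
    (hx : x ^ Fintype.card F = x) : ∃ y : F, algebraMap F K y = x := by
  classical
  have h0 := FiniteField.X_pow_card_sub_X_ne_zero K (Fintype.one_lt_card (α := F))
  have h1 : Finset.univ.image (algebraMap F K) ⊆
      (Polynomial.X ^ Fintype.card F - Polynomial.X : Polynomial K).roots.toFinset := by
    intro z hz
    obtain ⟨y, -, rfl⟩ := Finset.mem_image.mp hz
    simp [h0, ← map_pow, FiniteField.pow_card]
  have h2 : x ∈ (Polynomial.X ^ Fintype.card F - Polynomial.X : Polynomial K).roots.toFinset := by
    simp [h0, hx]
  rw [← Finset.eq_of_subset_of_card_le h1] at h2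
  · simpa using h2
  · rw [Finset.card_image_of_injective _ (algebraMap F K).injective, Finset.card_univ]
    refine (Multiset.toFinset_card_le _).trans ((Polynomial.card_roots' _).trans ?_)
    rw [FiniteField.X_pow_card_sub_X_natDegree_eq K Fintype.one_lt_card]

lemma map_frobenius_comm (f : A →ₐ[F] C) (N : Grassmannian A (A ⊗[F] V) k) :
    (N.map (FiniteField.frobeniusAlgHom F A)).map f =
      (N.map f).map (FiniteField.frobeniusAlgHom F C) := by
  rw [← Grassmannian.map_comp, ← Grassmannian.map_comp]
  congr 1
  ext a
  simp

/-- A point of the Grassmannian over a field which is fixed by the Frobenius is defined over the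
finite base field. -/
lemma exists_map_eq_of_map_frobenius_eq {n m : ℕ} (hn : n = k + m) (b : Basis (Fin n) F V)
    {K : Type w} [Field K] [Algebra F K] {N : Grassmannian K (K ⊗[F] V) k}
    (hN : N.map (FiniteField.frobeniusAlgHom F K) = N) :
    ∃ N₀ : Grassmannian F (F ⊗[F] V) k, N₀.map (Algebra.ofId F K) = N := by
  obtain ⟨e, he⟩ := exists_inChart_of_field hn b N
  obtain ⟨a, rfl⟩ := (inChart_iff _).mp he
  -- The chart basis is defined over `F`, so Frobenius acts on the matrix entrywise and every entry
  -- is fixed.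
  rw [chart_map] at hN
  have ha := chart_injective _ hN
  choose a' ha' using fun j i => mem_range_algebraMap_of_pow_card_eq (F := F)
    (x := a j i) (congrFun (congrFun ha j) i)
  refine ⟨chart (b.reindex e) a', ?_⟩
  rw [chart_map]
  congr 1
  ext j i
  exact ha' j i

variable {B : LinearMap.BilinForm F V}

/-- For a nonsplit form, a totally isotropic submodule and its Frobenius twist are nowhere
orthogonal. -/
lemma pairIdeal_map_frobenius_eq_top [FiniteDimensional F V] (hB : B.Nondegenerate)
    (hV : finrank F V = 2 * k)
    (hsplit : ¬ ∃ W : Submodule F V, finrank F W = k ∧ ∀ u ∈ W, ∀ v ∈ W, B u v = 0)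
    {N : Grassmannian A (A ⊗[F] V) k} (hN : Isotropic B N.toSubmodule) :
    pairIdeal B N.toSubmodule (N.map (FiniteField.frobeniusAlgHom F A)).toSubmodule = ⊤ := by
  by_contra hne
  obtain ⟨P, hP, hle⟩ := Ideal.exists_le_maximal _ hne
  let K := A ⧸ P
  let _ : Field K := Ideal.Quotient.field P
  let f : A →ₐ[F] K := Ideal.Quotient.mkₐ F P
  have hbot : pairIdeal B (N.map f).toSubmodule
      ((N.map f).map (FiniteField.frobeniusAlgHom F K)).toSubmodule = ⊥ := by
    rw [← map_frobenius_comm, pairIdeal_map, eq_bot_iff, Ideal.map_le_iff_le_comap]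
    intro x hx
    exact Ideal.Quotient.eq_zero_iff_mem.mpr (hle hx)
  -- The fibre at the chosen maximal ideal is orthogonal to its twist; the twist is self-orthogonal,
  -- so it contains the fibre and equals it by rank.
  have hfix : (N.map f).map (FiniteField.frobeniusAlgHom F K) = N.map f := by
    symm
    refine Grassmannian.eq_of_le fun x hx => ?_
    refine mem_of_orthogonal hB hV ((hN.map f).map _) fun y hy => ?_
    exact pairIdeal_eq_bot_iff.mp hbot x hx y hy
  obtain ⟨N₀, hN₀⟩ := exists_map_eq_of_map_frobenius_eq (two_mul k)
    (finBasisOfFinrankEq F V hV) hfix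
  refine hsplit (exists_isotropic_of_grassmannian hV (N := N₀) fun u hu v hv => ?_)
  have h1 := hN.map f _ (hN₀ ▸ bc_mem_map _ _ hu) _ (hN₀ ▸ bc_mem_map _ _ hv)
  rw [baseChange_bc] at h1
  exact (algebraMap F K).injective (h1.trans (map_zero _).symm)

end Frobenius

end

end OrthDL

/-! ### Representability from an open cover by subfunctors -/

namespace OrthDL

noncomputable section

/-- A Zariski sheaf with small values which is covered by open subfunctors represented by schemes
is representable. -/
lemma isRepresentable_of_openCover {H : Scheme.{0}ᵒᵖ ⥤ Type w}
    (hH : Presieve.IsSheaf Scheme.zariskiTopology.{0} H) [hs : ∀ S, Small.{0} (H.obj S)]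
    {ι : Type} (X : ι → Scheme.{0}) (ξ : ∀ i, H.obj (op (X i)))
    (hopen : ∀ (S : Scheme.{0}) (s : H.obj (op S)) (i : ι), ∃ (U : S.Opens)
      (h : U.toScheme ⟶ X i), H.map h.op (ξ i) = H.map U.ι.op s ∧
        ∀ (T : Scheme.{0}) (a : T ⟶ X i) (b : T ⟶ S), H.map a.op (ξ i) = H.map b.op s →
          ∃ c : T ⟶ U.toScheme, c ≫ h = a ∧ c ≫ U.ι = b)
    (hcover : ∀ (S : Scheme.{0}) (s : H.obj (op S)) (t : S), ∃ (i : ι) (U : S.Opens)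
      (h : U.toScheme ⟶ X i), t ∈ U ∧ H.map h.op (ξ i) = H.map U.ι.op s) :
    H.IsRepresentable := by
  -- Subbundles are families over all algebras and live in a larger universe; smallness permits an
  -- equivalent functor with values in `Type`.
  let H' : Scheme.{0}ᵒᵖ ⥤ Type := FunctorToTypes.shrink.{0} H
  have hH' : Presheaf.IsSheaf Scheme.zariskiTopology.{0} H' := by
    rw [isSheaf_iff_isSheaf_of_type]
    refine (Presieve.isSheaf_iff_of_nat_equiv (P₁ := H) (P₂ := H')
      (fun {S} => equivShrink.{0} (H.obj (op S))) ?_).mp hH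
    intro S T f x
    simp [H']
  let F : Sheaf Scheme.zariskiTopology.{0} Type := ⟨H', hH'⟩
  have hmap : ∀ {S T : Scheme.{0}} (f : T ⟶ S) (x : H.obj (op S)),
      H'.map f.op (equivShrink _ x) = equivShrink _ (H.map f.op x) := fun f x => by simp [H']
  let f : ∀ i, yoneda.obj (X i) ⟶ F.1 := fun i => yonedaEquiv.symm (equivShrink _ (ξ i))
  have hf' : ∀ {i : ι} {T : Scheme.{0}} (a : T ⟶ X i),
      (f i).app (op T) a = equivShrink _ (H.map a.op (ξ i)) := fun a => by
    rw [← hmap]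
    rfl
  have hf : ∀ i, IsOpenImmersion.presheaf (f i) := by
    intro i
    refine MorphismProperty.relative.of_exists fun S g => ?_
    obtain ⟨s, rfl⟩ := yonedaEquiv.symm.surjective g
    obtain ⟨s, rfl⟩ := (equivShrink _).surjective s
    obtain ⟨U, h, hs, hU⟩ := hopen S s i
    have hg : ∀ {T : Scheme.{0}} (b : T ⟶ S),
        (yonedaEquiv.symm (equivShrink _ s) : yoneda.obj S ⟶ H').app (op T) b =
          equivShrink _ (H.map b.op s) := fun b => by
      rw [← hmap]
      rfl
    refine ⟨U.toScheme, yoneda.map h, U.ι, ?_, inferInstanceAs (IsOpenImmersion U.ι)⟩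
    refine IsPullback.of_forall_isPullback_app fun T => ?_
    induction T using Opposite.rec with | _ T
    rw [Limits.Types.isPullback_iff]
    refine ⟨?_, ?_, ?_⟩
    · ext c
      refine (hf' (c ≫ h)).trans (Eq.trans ?_ (hg (c ≫ U.ι)).symm)
      rw [op_comp, op_comp, Functor.map_comp_apply, Functor.map_comp_apply, hs]
    · intro c c' hc
      exact (cancel_mono U.ι).mp hc.2
    · intro a b hab
      obtain ⟨c, hc, hc'⟩ := hU T a b
        ((equivShrink _).injective ((hf' a).symm.trans (Eq.trans hab (hg b))))
      exact ⟨c, hc, hc'⟩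
  have hsurj : Presheaf.IsLocallySurjective Scheme.zariskiTopology (Limits.Sigma.desc f) := by
    refine ⟨fun {S} x => ?_⟩
    obtain ⟨s, rfl⟩ := (equivShrink (H.obj (op S))).surjective x
    choose i U h ht hs using hcover S s
    let 𝓤 : S.OpenCover := S.openCoverOfIsOpenCover U
      (.mk (eq_top_iff.mpr fun t _ => TopologicalSpace.Opens.mem_iSup.mpr ⟨t, ht t⟩))
    refine GrothendieckTopology.superset_covering _ ?_ 𝓤.mem_grothendieckTopology
    rw [Sieve.ofArrows, Sieve.generate_le_iff]
    rintro _ _ ⟨t⟩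
    refine ⟨(Limits.Sigma.ι (fun i => yoneda.obj (X i)) (i t)).app _ (h t), ?_⟩
    have hι := congrArg (fun α => α.app (op (U t).toScheme) (h t)) (Limits.Sigma.ι_desc f (i t))
    exact (hι.trans (hf' (h t))).trans ((congrArg _ (hs t)).trans (hmap (U t).ι s).symm)
  have : H'.IsRepresentable := Scheme.LocalRepresentability.isRepresentable hf
  obtain ⟨X₀, ⟨e⟩⟩ := this
  refine ⟨X₀, ⟨⟨fun {T} => e.homEquiv.trans (equivShrink (H.obj (op T))).symm, ?_⟩⟩⟩
  intro T T' f g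
  rw [Equiv.trans_apply, Equiv.symm_apply_eq, e.homEquiv_comp, Equiv.trans_apply, ← hmap,
    Equiv.apply_symm_apply]

end

end OrthDL

/-! ### Morphisms of schemes tested on affine schemes over `𝔽_p` -/

namespace OrthDL

noncomputable section

variable {p : ℕ}

/-- The inclusion of a standard open subscheme of an affine scheme. -/
abbrev awayMap {R : CommAlgCat.{0} (ZMod p)} (r : R) :
    Spec (CommRingCat.of (CommAlgCat.of (ZMod p) (Localization.Away r))) ⟶
      Spec (CommRingCat.of R) :=
  specMap p (CommAlgCat.ofHom (awayHom (ZMod p) r))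

lemma range_awayMap {R : CommAlgCat.{0} (ZMod p)} (r : R) :
    Set.range (awayMap r) = (PrimeSpectrum.basicOpen (r : R) : Set (PrimeSpectrum R)) :=
  PrimeSpectrum.localization_away_comap_range (Localization.Away r) r

/-- Elements `r` such that `Spec R_r` lies in members of an open cover of the target generate the
unit ideal. -/
lemma span_eq_top_of_openCover {S : Scheme.{0}} {R : CommAlgCat.{0} (ZMod p)}
    (x : Spec (CommRingCat.of R) ⟶ S) (Q : Set R)
    (h : ∀ t : Spec (CommRingCat.of R), ∃ (Y : Scheme.{0}) (i : Y ⟶ S) (_ : IsOpenImmersion i),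
      x t ∈ Set.range i ∧ ∀ r : R, (∃ y, awayMap r ≫ x = y ≫ i) → r ∈ Q) :
    Ideal.span Q = ⊤ := by
  by_contra hne
  obtain ⟨P, hP, hle⟩ := Ideal.exists_le_maximal _ hne
  obtain ⟨Y, i, hi, hx, hQ⟩ := h ⟨P, hP.isPrime⟩
  obtain ⟨_, ⟨r, rfl⟩, hr, hsub⟩ :=
    PrimeSpectrum.isTopologicalBasis_basic_opens.exists_subset_of_mem_open
    (show (⟨P, hP.isPrime⟩ : PrimeSpectrum R) ∈ x ⁻¹' Set.range i from hx)
    (i.isOpenEmbedding.isOpen_range.preimage x.continuous)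
  have hrange : Set.range (awayMap (p := p) r ≫ x) ⊆ Set.range i := by
    rintro _ ⟨t, rfl⟩
    have : awayMap (p := p) r t ∈ Set.range (awayMap (p := p) r) := ⟨t, rfl⟩
    rw [range_awayMap] at this
    rw [Scheme.Hom.comp_apply]
    exact hsub this
  exact hr (hle (Ideal.subset_span (hQ r ⟨IsOpenImmersion.lift i _ hrange,
    (IsOpenImmersion.lift_fac i _ hrange).symm⟩)))

/-- A morphism of affine schemes in characteristic `p` comes from a homomorphism of
`𝔽_p`-algebras. -/
lemma exists_eq_specMap {R R' : CommAlgCat.{0} (ZMod p)}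
    (f : Spec (CommRingCat.of R') ⟶ Spec (CommRingCat.of R)) : ∃ φ : R ⟶ R', f = specMap p φ := by
  let ψ : (R : Type) →+* R' := (Spec.preimage f).hom
  refine ⟨CommAlgCat.ofHom ⟨ψ, fun a => ?_⟩, ?_⟩
  · exact RingHom.congr_fun (Subsingleton.elim (ψ.comp (algebraMap (ZMod p) R))
      (algebraMap (ZMod p) R')) a
  · rw [← Spec.map_preimage f]
    rfl

variable [Fact p.Prime]

/-- The `𝔽_p`-algebra structure on a ring whose spectrum lies over `𝔽_{p²}`. -/
def algOf {R : CommRingCat.{0}} (g : Spec R ⟶ base p) : CommAlgCat.{0} (ZMod p) :=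
  letI := ((Spec.preimage g).hom.comp (algebraMap (ZMod p) (GaloisField p 2))).toAlgebra
  CommAlgCat.of (ZMod p) R

lemma hom_ext_of_affine {S X : Scheme.{0}} (g : S ⟶ base p) {h h' : S ⟶ X}
    (H : ∀ (R : CommAlgCat.{0} (ZMod p)) (x : Spec (CommRingCat.of R) ⟶ S), x ≫ h = x ≫ h') :
    h = h' :=
  S.affineOpenCover.openCover.hom_ext _ _ fun j =>
    H (algOf (S.affineOpenCover.f j ≫ g)) (S.affineOpenCover.f j)

/-- A morphism of schemes is a compatible family of values on affine schemes. -/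
lemma exists_hom_of_affine {S X : Scheme.{0}} (g : S ⟶ base p)
    (φ : ∀ (R : CommAlgCat.{0} (ZMod p)), (Spec (CommRingCat.of R) ⟶ S) →
      (Spec (CommRingCat.of R) ⟶ X))
    (hφ : ∀ {R R' : CommAlgCat.{0} (ZMod p)} (f : R ⟶ R') (x : Spec (CommRingCat.of R) ⟶ S),
      φ R' (specMap p f ≫ x) = specMap p f ≫ φ R x) :
    ∃ h : S ⟶ X, ∀ (R : CommAlgCat.{0} (ZMod p)) (x : Spec (CommRingCat.of R) ⟶ S),
      x ≫ h = φ R x := by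
  have hφ' : ∀ {R R' : CommAlgCat.{0} (ZMod p)}
      (f : Spec (CommRingCat.of R') ⟶ Spec (CommRingCat.of R)) (x : Spec (CommRingCat.of R) ⟶ S),
      φ R' (f ≫ x) = f ≫ φ R x := fun f x => by
    obtain ⟨f, rfl⟩ := exists_eq_specMap f
    exact hφ f x
  let 𝓤 := S.affineOpenCover
  let A : 𝓤.I₀ → CommAlgCat.{0} (ZMod p) := fun j => algOf (𝓤.f j ≫ g)
  let fA : ∀ j, Spec (CommRingCat.of (A j)) ⟶ S := fun j => 𝓤.f j
  let h : S ⟶ X := 𝓤.openCover.glueMorphisms (fun j => φ (A j) (fA j)) fun i j => by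
    refine hom_ext_of_affine (Limits.pullback.fst (fA i) (fA j) ≫ fA i ≫ g) fun R x => ?_
    have h1 := hφ' (R := A i) (x ≫ Limits.pullback.fst (fA i) (fA j)) (fA i)
    have h2 := hφ' (R := A j) (x ≫ Limits.pullback.snd (fA i) (fA j)) (fA j)
    rw [Category.assoc] at h1 h2
    refine h1.symm.trans (Eq.trans ?_ h2)
    rw [Limits.pullback.condition]
  have hh : ∀ j, fA j ≫ h = φ (A j) (fA j) := fun j => 𝓤.openCover.ι_glueMorphisms _ _ j
  refine ⟨h, fun R x => ?_⟩
  refine Scheme.Cover.hom_ext (𝓤.openCover.pullback₁ x) _ _ fun (j : 𝓤.I₀) => ?_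
  refine hom_ext_of_affine (Limits.pullback.fst x (fA j) ≫ x ≫ g) fun R' z => ?_
  change z ≫ Limits.pullback.fst x (fA j) ≫ x ≫ h = z ≫ Limits.pullback.fst x (fA j) ≫ φ R x
  have h1 := hφ' (z ≫ Limits.pullback.fst x (fA j)) x
  have h2 := hφ' (R := A j) (z ≫ Limits.pullback.snd x (fA j)) (fA j)
  rw [Category.assoc] at h1 h2
  rw [Limits.pullback.condition_assoc, hh, ← Category.assoc, ← Category.assoc, ← h1, ← h2,
    Limits.pullback.condition]

end

end OrthDL

/-! ### The Grassmannian as a small Zariski sheaf -/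

namespace OrthDL

noncomputable section

lemma awayMapₐ_comp_awayHom {F A B : Type*} [CommRing F] [CommRing A] [CommRing B] [Algebra F A]
    [Algebra F B] (f : A →ₐ[F] B) (a : A) :
    (Localization.awayMapₐ f a).comp (awayHom F a) = (awayHom F (f a)).comp f := by
  refine AlgHom.ext fun b => ?_
  rw [AlgHom.comp_apply, AlgHom.comp_apply, IsScalarTower.toAlgHom_apply,
    IsScalarTower.toAlgHom_apply, IsLocalization.Away.mapₐ_apply, IsLocalization.Away.map,
    IsLocalization.map_eq]
  rfl

variable {p : ℕ}

lemma specMap_comp_assoc {R R' R'' : CommAlgCat.{0} (ZMod p)} (f : R ⟶ R') (g : R' ⟶ R'')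
    {S : Scheme.{0}} (x : Spec (CommRingCat.of R) ⟶ S) :
    specMap p g ≫ specMap p f ≫ x = specMap p (f ≫ g) ≫ x := by
  rw [← Category.assoc, ← Spec.map_comp]
  rfl

lemma specMap_id_comp {R : CommAlgCat.{0} (ZMod p)} {S : Scheme.{0}}
    (x : Spec (CommRingCat.of R) ⟶ S) : specMap p (𝟙 R) ≫ x = x := by
  have : specMap p (𝟙 R) = 𝟙 _ := Spec.map_id _
  rw [this, Category.id_comp]

/-- Transfers a covering sieve on `S` to a cover of `Spec R` by standard opens, where gluing is
module theory. -/
lemma span_eq_top_of_mem_zariskiTopology {S : Scheme.{0}} {𝒮 : Sieve S}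
    (h𝒮 : 𝒮 ∈ Scheme.zariskiTopology.{0} S) {R : CommAlgCat.{0} (ZMod p)}
    (x : Spec (CommRingCat.of R) ⟶ S) : Ideal.span {a : R | 𝒮 (awayMap (p := p) a ≫ x)} = ⊤ := by
  obtain ⟨𝓤, h𝓤⟩ := Scheme.mem_grothendieckTopology_iff.mp h𝒮
  refine span_eq_top_of_openCover x _ fun t => ⟨_, 𝓤.f (𝓤.idx (x t)), inferInstance,
    𝓤.covers _, ?_⟩
  rintro a ⟨y, hy⟩
  change 𝒮 (awayMap a ≫ x)
  rw [hy]
  exact 𝒮.downward_closed (h𝓤 _ _ (Presieve.ofArrows.mk _)) y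

variable [Fact p.Prime] {V : Type u} [AddCommGroup V] [Module (ZMod p) V] {r : ℕ}

open Module

namespace Subbundle

lemma fiber_id_pullback {S : Scheme.{0}} (L : Subbundle p V r S) {R : CommAlgCat.{0} (ZMod p)}
    (x : Spec (CommRingCat.of R) ⟶ S) : (L.pullback x).fiber R (𝟙 _) = L.fiber R x := by
  simp [pullback]

lemma fiber_map_away {S : Scheme.{0}} (L : Subbundle p V r S) {R : CommAlgCat.{0} (ZMod p)}
    (x : Spec (CommRingCat.of R) ⟶ S) (a : R) :
    (L.fiber R x).map (awayHom (ZMod p) a) =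
      L.fiber (CommAlgCat.of (ZMod p) (Localization.Away a)) (awayMap a ≫ x) :=
  (L.fiber_map (CommAlgCat.ofHom (awayHom (ZMod p) a)) x).symm

section Glue

variable [Module.Finite (ZMod p) V] {S : Scheme.{0}} {𝒮 : Sieve S}

/-- An affine point need not belong to the sieve, so its fibre is glued from standard opens that do.
Requiring the value over every `R'` in the sieve makes the fibre unique, and this uniqueness yields
compatibility with base change. -/
lemma existsUnique_glue_fiber (h𝒮 : 𝒮 ∈ Scheme.zariskiTopology.{0} S)
    (L : ∀ ⦃Y : Scheme.{0}⦄ (f : Y ⟶ S), 𝒮 f → Subbundle p V r Y)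
    (hL : ∀ ⦃Y Z : Scheme.{0}⦄ (f : Y ⟶ S) (g : Z ⟶ Y) (hf : 𝒮 f),
      L (g ≫ f) (𝒮.downward_closed hf g) = (L f hf).pullback g)
    (R : CommAlgCat.{0} (ZMod p)) (x : Spec (CommRingCat.of R) ⟶ S) :
    ∃! N : Grassmannian R (R ⊗[ZMod p] V) (finrank (ZMod p) V - r),
      ∀ (R' : CommAlgCat.{0} (ZMod p)) (g : R ⟶ R') (h : 𝒮 (specMap p g ≫ x)),
        N.map g.hom = (L _ h).fiber R' (𝟙 _) := by
  have hT := span_eq_top_of_mem_zariskiTopology h𝒮 x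
  have hM : ∀ {R' R'' : CommAlgCat.{0} (ZMod p)} (y : Spec (CommRingCat.of R') ⟶ S) (hy : 𝒮 y)
      (y' : Spec (CommRingCat.of R'') ⟶ S) (hy' : 𝒮 y') (g : R' ⟶ R''), y' = specMap p g ≫ y →
      ((L y hy).fiber R' (𝟙 _)).map g.hom = (L y' hy').fiber R'' (𝟙 _) := by
    rintro R' R'' y hy _ hy' g rfl
    rw [hL, fiber_id_pullback, ← fiber_map, Category.comp_id]
  refine existsUnique_of_exists_of_unique ?_ fun N N' hN hN' => ?_
  · obtain ⟨T, hTsub, hT'⟩ := (Ideal.span_eq_top_iff_finite _).mp hT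
    let N₀ : ∀ a ∈ (T : Set R), Grassmannian (Localization.Away a)
        (Localization.Away a ⊗[ZMod p] V) (finrank (ZMod p) V - r) := fun a ha =>
      (L (awayMap a ≫ x) (hTsub ha)).fiber (CommAlgCat.of (ZMod p) (Localization.Away a)) (𝟙 _)
    have hN₀ : ∀ (C : CommAlgCat.{0} (ZMod p)) (f : R ⟶ C) (h1 : 𝒮 (specMap p f ≫ x)) (a : R)
        (ha : a ∈ (T : Set R)) (g : Localization.Away a →ₐ[ZMod p] C),
        g.comp (awayHom (ZMod p) a) = f.hom → (N₀ a ha).map g = (L _ h1).fiber C (𝟙 _) := by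
      intro C f h1 a ha g hg
      refine hM _ (hTsub ha) _ h1 (CommAlgCat.ofHom g) ?_
      rw [specMap_comp_assoc]
      congr 2
      exact CommAlgCat.hom_ext hg.symm
    obtain ⟨N, hN⟩ := Grassmannian.exists_glue T hT' N₀ fun a ha b hb C _ _ g h hgh => by
      have h1 : 𝒮 (specMap p (CommAlgCat.ofHom (g.comp (awayHom (ZMod p) a))) ≫ x) := by
        have := 𝒮.downward_closed (hTsub ha) (specMap p (CommAlgCat.ofHom g))
        rwa [specMap_comp_assoc] at this
      exact (hN₀ (CommAlgCat.of _ C) _ h1 a ha g rfl).trans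
        (hN₀ (CommAlgCat.of _ C) _ h1 b hb h hgh.symm).symm
    refine ⟨N, fun R' g h => ?_⟩
    refine Grassmannian.ext_away (T := g.hom '' T) ?_ ?_
    · change Ideal.span ((g.hom : (R : Type) →+* R') '' T) = ⊤
      rw [← Ideal.map_span, hT', Ideal.map_top]
    · rintro _ ⟨a, ha, rfl⟩
      have h1 : 𝒮 (awayMap (g.hom a) ≫ specMap p g ≫ x) := 𝒮.downward_closed h _
      let l := Localization.awayMapₐ g.hom a
      have hl : l.comp (awayHom (ZMod p) a) = (awayHom (ZMod p) (g.hom a)).comp g.hom :=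
        awayMapₐ_comp_awayHom g.hom a
      rw [← Grassmannian.map_comp, ← hl, Grassmannian.map_comp, hN a ha]
      rw [specMap_comp_assoc] at h1
      exact (hN₀ _ _ h1 a ha l hl).trans
        (hM _ h _ h1 (CommAlgCat.ofHom (awayHom (ZMod p) (g.hom a)))
          (specMap_comp_assoc _ _ _).symm).symm
  · refine Grassmannian.ext_away hT fun a ha => ?_
    exact (hN _ (CommAlgCat.ofHom (awayHom (ZMod p) a)) ha).trans
      (hN' _ (CommAlgCat.ofHom (awayHom (ZMod p) a)) ha).symm

lemma existsUnique_glue (h𝒮 : 𝒮 ∈ Scheme.zariskiTopology.{0} S)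
    (L : ∀ ⦃Y : Scheme.{0}⦄ (f : Y ⟶ S), 𝒮 f → Subbundle p V r Y)
    (hL : ∀ ⦃Y Z : Scheme.{0}⦄ (f : Y ⟶ S) (g : Z ⟶ Y) (hf : 𝒮 f),
      L (g ≫ f) (𝒮.downward_closed hf g) = (L f hf).pullback g) :
    ∃! L₀ : Subbundle p V r S, ∀ ⦃Y : Scheme.{0}⦄ (f : Y ⟶ S) (hf : 𝒮 f),
      L₀.pullback f = L f hf := by
  have hcongr : ∀ {R : CommAlgCat.{0} (ZMod p)} {y y' : Spec (CommRingCat.of R) ⟶ S} (hy : 𝒮 y)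
      (hy' : 𝒮 y'), y = y' → (L y hy).fiber R (𝟙 _) = (L y' hy').fiber R (𝟙 _) := by
    rintro R y _ hy hy' rfl
    rfl
  choose N hN hN' using existsUnique_glue_fiber h𝒮 L hL
  refine ⟨⟨N, ?_⟩, ?_, ?_⟩
  · intro R R' f x
    refine (hN' _ _ _ fun R'' g h => ?_).symm
    have h' : 𝒮 (specMap p (f ≫ g) ≫ x) := by rwa [← specMap_comp_assoc]
    rw [← Grassmannian.map_comp]
    refine (hN R x R'' (f ≫ g) h').trans ?_
    exact hcongr _ _ (specMap_comp_assoc f g x).symm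
  · intro Y f hf
    ext R y : 3
    have hf' := 𝒮.downward_closed hf y
    have h' : 𝒮 (specMap p (𝟙 R) ≫ y ≫ f) := by rwa [specMap_id_comp]
    refine ((Grassmannian.map_id _ _ _).symm.trans (hN R (y ≫ f) R (𝟙 R) h')).trans ?_
    rw [← fiber_id_pullback (L f hf), ← hL]
    exact hcongr _ _ (specMap_id_comp _)
  · intro L' hL'
    ext R x : 3
    refine hN' _ _ _ fun R' g h => ?_
    rw [← fiber_map, ← hL', fiber_id_pullback]

end Glue

lemma small_grassmannian [Module.Finite (ZMod p) V] (R : Type) [CommRing R] [Algebra (ZMod p) R]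
    (k : ℕ) : Small.{0} (Grassmannian R (R ⊗[ZMod p] V) k) := by
  have : Small.{0} (R ⊗[ZMod p] V) :=
    small_map (Algebra.TensorProduct.basis R (finBasis (ZMod p) V)).equivFun.toEquiv
  exact small_of_injective (β := Set (R ⊗[ZMod p] V)) (f := fun N => (N.toSubmodule : Set _))
    fun N N' h => Grassmannian.ext (SetLike.coe_injective h)

/-- Although indexed by all algebras, a subbundle is determined by its values on one affine open
cover. -/
lemma small_of_hom [Module.Finite (ZMod p) V] {S : Scheme.{0}} (g : S ⟶ base p) :
    Small.{0} (Subbundle p V r S) := by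
  let A : S.affineOpenCover.I₀ → CommAlgCat.{0} (ZMod p) :=
    fun j => algOf (S.affineOpenCover.f j ≫ g)
  let fA : ∀ j, Spec (CommRingCat.of (A j)) ⟶ S := fun j => S.affineOpenCover.f j
  have := fun j => small_grassmannian (p := p) (V := V) (A j) (finrank (ZMod p) V - r)
  refine small_of_injective (f := fun (L : Subbundle p V r S) j => L.fiber (A j) (fA j))
    fun L L' h => ?_
  ext R x : 3
  have hT := span_eq_top_of_openCover x {a : R | L.fiber _ (awayMap (p := p) a ≫ x) =
    L'.fiber _ (awayMap (p := p) a ≫ x)} fun t => ⟨_, fA (S.affineOpenCover.idx (x t)),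
      inferInstanceAs (IsOpenImmersion (S.affineOpenCover.f _)), S.affineOpenCover.covers (x t), ?_⟩
  · refine Grassmannian.ext_away hT fun a ha => ?_
    rw [fiber_map_away, fiber_map_away]
    exact ha
  · rintro a ⟨y, hy⟩
    obtain ⟨φ, rfl⟩ := exists_eq_specMap y
    change L.fiber _ (awayMap (p := p) a ≫ x) = L'.fiber _ (awayMap (p := p) a ≫ x)
    rw [hy, fiber_map, fiber_map]
    exact congrArg _ (congrFun h _)

end Subbundle

variable (p V r) in
/-- The functor of pairs of a morphism to `Spec 𝔽_{p²}` and an element of the Grassmannian. -/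
def grFunctor : Scheme.{0}ᵒᵖ ⥤ Type (max 1 u) where
  obj S := (S.unop ⟶ base p) × Subbundle p V r S.unop
  map f := ↾fun y => (f.unop ≫ y.1, y.2.pullback f.unop)
  map_id S := by
    refine ConcreteCategory.hom_ext _ _ fun y => ?_
    exact Prod.ext (Category.id_comp _) (Subbundle.pullback_id _)
  map_comp f g := by
    refine ConcreteCategory.hom_ext _ _ fun y => ?_
    exact Prod.ext (Category.assoc _ _ _) (Subbundle.pullback_comp _ _ _)

instance [Module.Finite (ZMod p) V] (S : Scheme.{0}ᵒᵖ) : Small.{0} ((grFunctor p V r).obj S) := by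
  change Small.{0} ((S.unop ⟶ base p) × Subbundle p V r S.unop)
  cases isEmpty_or_nonempty (S.unop ⟶ base p) with
  | inl h => exact small_of_injective (β := PEmpty) (f := fun y => h.elim y.1) fun y => h.elim y.1
  | inr h =>
    have := Subbundle.small_of_hom (V := V) (r := r) h.some
    infer_instance

lemma isSheaf_grFunctor [Module.Finite (ZMod p) V] :
    Presieve.IsSheaf Scheme.zariskiTopology.{0} (grFunctor p V r) := by
  intro S 𝒮 h𝒮 x hx
  rw [Presieve.compatible_iff_sieveCompatible] at hx
  let x₁ : Presieve.FamilyOfElements (yoneda.obj (base p)) 𝒮.arrows := fun Y f hf => (x f hf).1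
  have hx₁ : x₁.Compatible := (Presieve.compatible_iff_sieveCompatible x₁).mpr
    fun Y Z f g hf => congrArg Prod.fst (hx f g hf)
  have h1 := (GrothendieckTopology.Subcanonical.isSheaf_of_isRepresentable
    (J := Scheme.zariskiTopology.{0}) (yoneda.obj (base p))) 𝒮 h𝒮 x₁ hx₁
  obtain ⟨g, hg, hg'⟩ := h1
  obtain ⟨L, hL, hL'⟩ := Subbundle.existsUnique_glue h𝒮 (fun Y f hf => (x f hf).2)
    (fun Y Z f g hf => congrArg Prod.snd (hx f g hf))
  refine ⟨(g, L), fun Y f hf => Prod.ext (hg f hf) (hL f hf), fun y hy => Prod.ext ?_ ?_⟩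
  · exact hg' y.1 fun Y f hf => congrArg Prod.fst (hy f hf)
  · exact hL' y.2 fun Y f hf => congrArg Prod.snd (hy f hf)

end

end OrthDL

/-! ### Representability of the Grassmannian -/

namespace OrthDL

noncomputable section

variable {p : ℕ} [Fact p.Prime] {V : Type u} [AddCommGroup V] [Module (ZMod p) V] {r : ℕ}

open Module

section Chart

variable (p) in
/-- The affine space of matrices over `𝔽_{p²}`. -/
abbrev matrixScheme (m k : ℕ) : Scheme.{0} :=
  Spec (CommRingCat.of (MvPolynomial (Fin m × Fin k) (GaloisField p 2)))

variable (p) in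
/-- The structure morphism of the affine space of matrices. -/
def matrixScheme.toBase (m k : ℕ) : matrixScheme p m k ⟶ base p :=
  Spec.map (CommRingCat.ofHom MvPolynomial.C)

/-- The matrix of a point of the affine space of matrices. -/
def coordMatrix {m k : ℕ} {R : CommAlgCat.{0} (ZMod p)}
    (x : Spec (CommRingCat.of R) ⟶ matrixScheme p m k) : Fin m → Fin k → R :=
  fun j i => (Spec.preimage x).hom (MvPolynomial.X (j, i))

lemma coordMatrix_comp {m k : ℕ} {R R' : CommAlgCat.{0} (ZMod p)} (f : R ⟶ R')
    (x : Spec (CommRingCat.of R) ⟶ matrixScheme p m k) :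
    coordMatrix (specMap p f ≫ x) = fun j i => f.hom (coordMatrix x j i) := by
  have : Spec.preimage (specMap p f ≫ x) =
      Spec.preimage x ≫ CommRingCat.ofHom f.hom.toRingHom := by
    apply Spec.map_injective
    rw [Spec.map_preimage, Spec.map_comp, Spec.map_preimage]
  ext j i
  rw [coordMatrix, this]
  rfl

lemma hom_matrixScheme_ext {m k : ℕ} {R : CommAlgCat.{0} (ZMod p)}
    {x y : Spec (CommRingCat.of R) ⟶ matrixScheme p m k}
    (h : x ≫ matrixScheme.toBase p m k = y ≫ matrixScheme.toBase p m k)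
    (h' : coordMatrix x = coordMatrix y) : x = y := by
  apply Spec.homEquiv.injective
  refine CommRingCat.hom_ext (MvPolynomial.ringHom_ext' ?_ fun l => congrFun (congrFun h' l.1) l.2)
  rw [matrixScheme.toBase, ← Spec.map_preimage x, ← Spec.map_preimage y, ← Spec.map_comp,
    ← Spec.map_comp] at h
  exact congrArg CommRingCat.Hom.hom (Spec.map_injective h)

lemma exists_hom_matrixScheme {m k : ℕ} {R : CommAlgCat.{0} (ZMod p)}
    (g : Spec (CommRingCat.of R) ⟶ base p) (a : Fin m → Fin k → R) :
    ∃ x : Spec (CommRingCat.of R) ⟶ matrixScheme p m k, x ≫ matrixScheme.toBase p m k = g ∧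
      coordMatrix x = a := by
  refine ⟨Spec.map (CommRingCat.ofHom (MvPolynomial.eval₂Hom (Spec.preimage g).hom
    fun l => a l.1 l.2)), ?_, ?_⟩
  · rw [matrixScheme.toBase, ← Spec.map_comp]
    refine Eq.trans ?_ (Spec.map_preimage g)
    congr 1
    ext c
    exact MvPolynomial.eval₂_C _ _ _
  · ext j i
    rw [coordMatrix, Spec.preimage_map]
    exact MvPolynomial.eval₂_X _ _ _

variable {m : ℕ} (b : Basis (Fin (finrank (ZMod p) V - r) ⊕ Fin m) (ZMod p) V)

/-- The universal point of the Grassmannian over a chart. -/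
def chartSubbundle : Subbundle p V r (matrixScheme p m (finrank (ZMod p) V - r)) where
  fiber R x := chart b (coordMatrix x)
  fiber_map f x := by rw [coordMatrix_comp, chart_map]

variable {S : Scheme.{0}}

lemma hom_ext_of_chartSubbundle {h h' : S ⟶ matrixScheme p m (finrank (ZMod p) V - r)}
    (hb : h ≫ matrixScheme.toBase p _ _ = h' ≫ matrixScheme.toBase p _ _)
    (hL : (chartSubbundle b).pullback h = (chartSubbundle b).pullback h') : h = h' := by
  refine hom_ext_of_affine (h ≫ matrixScheme.toBase p _ _) fun R x => ?_
  refine hom_matrixScheme_ext (by rw [Category.assoc, hb, Category.assoc]) ?_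
  exact chart_injective b (congrArg (fun L => L.fiber R x) hL)

lemma exists_pullback_chartSubbundle (g : S ⟶ base p) (L : Subbundle p V r S)
    (hL : ∀ (R : CommAlgCat.{0} (ZMod p)) (x : Spec (CommRingCat.of R) ⟶ S),
      InChart b (L.fiber R x)) :
    ∃ h : S ⟶ matrixScheme p m (finrank (ZMod p) V - r), h ≫ matrixScheme.toBase p _ _ = g ∧
      (chartSubbundle b).pullback h = L := by
  choose a ha using fun R x => (inChart_iff b).mp (hL R x)
  choose φ hφ hφ' using fun (R : CommAlgCat.{0} (ZMod p)) (x : Spec (CommRingCat.of R) ⟶ S) =>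
    exists_hom_matrixScheme (x ≫ g) (a R x)
  obtain ⟨h, hh⟩ := exists_hom_of_affine g φ fun {R R'} f x => by
    refine hom_matrixScheme_ext ?_ ?_
    · rw [hφ, Category.assoc, Category.assoc, hφ]
    · rw [coordMatrix_comp, hφ', hφ']
      refine chart_injective b ?_
      rw [ha, L.fiber_map, ← ha, chart_map]
  refine ⟨h, hom_ext_of_affine g fun R x => ?_, ?_⟩
  · rw [← Category.assoc, hh, hφ]
  · ext R x : 3
    change chart b (coordMatrix (x ≫ h)) = _
    rw [hh, hφ', ha]

/-- The open subscheme where a point of the Grassmannian lies in a chart. -/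
def chartLocus (L : Subbundle p V r S) : S.Opens where
  carrier := {t | ∃ (R : CommAlgCat.{0} (ZMod p)) (x : Spec (CommRingCat.of R) ⟶ S),
    IsOpenImmersion x ∧ InChart b (L.fiber R x) ∧ t ∈ Set.range x}
  is_open' := by
    rw [isOpen_iff_forall_mem_open]
    rintro t ⟨R, x, hx, hL, ht⟩
    exact ⟨Set.range x, fun t' ht' => ⟨R, x, hx, hL, ht'⟩, x.isOpenEmbedding.isOpen_range, ht⟩

lemma inChart_of_range_subset {T : Scheme.{0}} {L : Subbundle p V r S} {z : T ⟶ S}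
    (hz : Set.range z ⊆ chartLocus b L) {R : CommAlgCat.{0} (ZMod p)}
    (x : Spec (CommRingCat.of R) ⟶ T) : InChart b (L.fiber R (x ≫ z)) := by
  refine inChart_of_away b (T := {a : R | InChart b (L.fiber _ (awayMap a ≫ x ≫ z))}) ?_ ?_
  · refine span_eq_top_of_openCover (x ≫ z) _ fun t => ?_
    obtain ⟨R', x', hx', hL, ht⟩ := hz ⟨x t, rfl⟩
    refine ⟨_, x', hx', by rwa [Scheme.Hom.comp_apply], ?_⟩
    rintro a ⟨y, hy⟩
    obtain ⟨f, rfl⟩ := exists_eq_specMap y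
    change InChart b (L.fiber _ (awayMap a ≫ x ≫ z))
    rw [hy, L.fiber_map]
    exact InChart.map b _ hL
  · intro a ha
    rw [Subbundle.fiber_map_away]
    exact ha

/-- The chart locus is defined by affine open neighbourhoods; openness of the chart condition
spreads it out from a single field-valued point. -/
lemma mem_chartLocus [Module.Finite (ZMod p) V] (g : S ⟶ base p) {L : Subbundle p V r S} {K : Type}
    [Field K] [Algebra (ZMod p) K]
    {y : Spec (CommRingCat.of (CommAlgCat.of (ZMod p) K)) ⟶ S}
    (h : InChart b (L.fiber (CommAlgCat.of (ZMod p) K) y))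
    (q : Spec (CommRingCat.of (CommAlgCat.of (ZMod p) K))) : y q ∈ chartLocus b L := by
  let 𝓤 := S.affineOpenCover
  let j := 𝓤.idx (y q)
  let A : CommAlgCat.{0} (ZMod p) := algOf (𝓤.f j ≫ g)
  let x : Spec (CommRingCat.of A) ⟶ S := 𝓤.f j
  have hx : IsOpenImmersion x := inferInstanceAs (IsOpenImmersion (𝓤.f j))
  have hrange : Set.range y ⊆ Set.range x := by
    rintro _ ⟨q', rfl⟩
    rw [show q' = q from Subsingleton.elim (α := PrimeSpectrum K) q' q]
    exact 𝓤.covers _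
  obtain ⟨φ, hφ⟩ := exists_eq_specMap (IsOpenImmersion.lift x y hrange)
  have hy : specMap p φ ≫ x = y := by rw [← hφ, IsOpenImmersion.lift_fac]
  rw [← hy, L.fiber_map] at h
  obtain ⟨a, ha, haL⟩ := exists_inChart_away b φ.hom (L.fiber A x) h
  rw [Subbundle.fiber_map_away] at haL
  refine ⟨_, awayMap a ≫ x, ?_, haL, ?_⟩
  · have : IsOpenImmersion (awayMap (p := p) a) :=
      inferInstanceAs (IsOpenImmersion (Spec.map (CommRingCat.ofHom
        (algebraMap A (Localization.Away a)))))
    infer_instance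
  · have h1 : specMap p φ q ∈ Set.range (awayMap (p := p) a) := by
      rw [range_awayMap]
      intro hmem
      exact q.isPrime.ne_top (Ideal.eq_top_of_isUnit_mem _ hmem (IsUnit.mk0 _ ha))
    obtain ⟨t, ht⟩ := h1
    exact ⟨t, by rw [← hy, Scheme.Hom.comp_apply, Scheme.Hom.comp_apply, ht]⟩

lemma exists_field_point (g : S ⟶ base p) (t : S) : ∃ (K : Type) (_ : Field K)
    (_ : Algebra (ZMod p) K) (y : Spec (CommRingCat.of (CommAlgCat.of (ZMod p) K)) ⟶ S)
    (q : Spec (CommRingCat.of (CommAlgCat.of (ZMod p) K))), y q = t := by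
  let y := S.fromSpecResidueField t
  refine ⟨S.residueField t, inferInstance, ((Spec.preimage (y ≫ g)).hom.comp
    (algebraMap (ZMod p) (GaloisField p 2))).toAlgebra, y, IsLocalRing.closedPoint _, ?_⟩
  exact S.fromSpecResidueField_apply t _

end Chart

/-- The Grassmannian is representable. -/
lemma isRepresentable_grFunctor [Module.Finite (ZMod p) V] (hr : r ≤ finrank (ZMod p) V) :
    (grFunctor p V r).IsRepresentable := by
  -- One chart for each reordering of a fixed basis; over a field these already reach every point.
  let b : (Fin (finrank (ZMod p) V) ≃ Fin (finrank (ZMod p) V - r) ⊕ Fin r) →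
      Basis (Fin (finrank (ZMod p) V - r) ⊕ Fin r) (ZMod p) V :=
    fun e => (finBasis (ZMod p) V).reindex e
  have hU : ∀ (S : Scheme.{0}) (g : S ⟶ base p) (L : Subbundle p V r S) e,
      ∃ h : (chartLocus (b e) L).toScheme ⟶ matrixScheme p r (finrank (ZMod p) V - r),
        h ≫ matrixScheme.toBase p _ _ = (chartLocus (b e) L).ι ≫ g ∧
          (chartSubbundle (b e)).pullback h = L.pullback (chartLocus (b e) L).ι :=
    fun S g L e => exists_pullback_chartSubbundle _ _ _ fun R x =>
      inChart_of_range_subset (b e) (by simp) x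
  refine isRepresentable_of_openCover isSheaf_grFunctor (fun _ => matrixScheme p r _)
    (fun e => (matrixScheme.toBase p _ _, chartSubbundle (b e))) ?_ ?_
  · rintro S ⟨g, L⟩ e
    obtain ⟨h, h1, h2⟩ := hU S g L e
    refine ⟨_, h, Prod.ext h1 h2, fun T a c hac => ?_⟩
    have hac₁ : a ≫ matrixScheme.toBase p _ _ = c ≫ g := congrArg Prod.fst hac
    have hac₂ : (chartSubbundle (b e)).pullback a = L.pullback c := congrArg Prod.snd hac
    -- A morphism along which the subbundle comes from the chart lands in the chart locus, as is
    -- checked on residue fields.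
    have hrange : Set.range c ⊆ Set.range (chartLocus (b e) L).ι := by
      rintro _ ⟨t, rfl⟩
      obtain ⟨K, _, _, y, q, rfl⟩ := exists_field_point (c ≫ g) t
      rw [← Scheme.Hom.comp_apply]
      have := mem_chartLocus (b e) g (L := L) (y := y ≫ c) (by
        have h3 := congrArg (fun L => L.fiber _ y) hac₂
        exact h3 ▸ (inChart_iff _).mpr ⟨_, rfl⟩) q
      simpa using this
    refine ⟨IsOpenImmersion.lift _ c hrange, ?_, IsOpenImmersion.lift_fac _ _ _⟩
    refine hom_ext_of_chartSubbundle (b e) ?_ ?_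
    · rw [Category.assoc, h1, IsOpenImmersion.lift_fac_assoc, hac₁]
    · rw [Subbundle.pullback_comp, h2, ← Subbundle.pullback_comp, IsOpenImmersion.lift_fac, hac₂]
  · rintro S ⟨g, L⟩ t
    obtain ⟨K, _, _, y, q, rfl⟩ := exists_field_point g t
    obtain ⟨e, he⟩ := exists_inChart_of_field (Nat.sub_add_cancel hr).symm (finBasis (ZMod p) V)
      (L.fiber _ y)
    obtain ⟨h, h1, h2⟩ := hU S g L e
    exact ⟨e, _, h, mem_chartLocus (b e) g he q, Prod.ext h1 h2⟩

end

end OrthDL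

/-! ### Closed subschemes defined by compatible ideals -/

namespace OrthDL

noncomputable section

variable {p : ℕ} [Fact p.Prime]

variable (p) in
/-- An ideal of functions on a scheme, given by its extensions to all affine schemes over it. -/
structure AffineIdeal (X : Scheme.{0}) where
  /-- the extension of the ideal along `x : Spec R ⟶ X` -/
  ideal (R : CommAlgCat.{0} (ZMod p)) (x : Spec (CommRingCat.of R) ⟶ X) : Ideal R
  ideal_map {R R' : CommAlgCat.{0} (ZMod p)} (f : R ⟶ R') (x : Spec (CommRingCat.of R) ⟶ X) :
    ideal R' (specMap p f ≫ x) = (ideal R x).map f.hom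

namespace AffineIdeal

variable {X : Scheme.{0}} (J : AffineIdeal p X) (g : X ⟶ base p)

/-- The value of the ideal on an affine scheme over `𝔽_{p²}`. -/
def val {A : CommRingCat.{0}} (x : Spec A ⟶ X) : Ideal A :=
  J.ideal (algOf (x ≫ g)) x

/-- Every ring homomorphism between `𝔽_p`-algebras is `𝔽_p`-linear, so compatibility along algebra
maps is compatibility along all ring maps. -/
lemma ideal_comp {A : CommRingCat.{0}} {R : CommAlgCat.{0} (ZMod p)} (x : Spec A ⟶ X)
    (f : A ⟶ CommRingCat.of R) : J.ideal R (Spec.map f ≫ x) = (J.val g x).map f.hom := by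
  obtain ⟨φ, hφ⟩ := exists_eq_specMap (R := algOf (x ≫ g)) (Spec.map f)
  have h1 : f.hom = φ.hom.toRingHom := congrArg CommRingCat.Hom.hom (Spec.map_injective hφ)
  rw [h1]
  exact (congrArg (fun y => J.ideal R (y ≫ x)) hφ).trans (J.ideal_map φ x)

lemma val_comp {A A' : CommRingCat.{0}} (x : Spec A ⟶ X) (f : A ⟶ A') :
    J.val g (Spec.map f ≫ x) = (J.val g x).map f.hom :=
  J.ideal_comp (R := algOf ((Spec.map f ≫ x) ≫ g)) g x f

/-- The ideal sheaf defined by compatible ideals. -/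
def sheaf : X.IdealSheafData where
  ideal U := J.val g U.2.fromSpec
  map_ideal_basicOpen U f := by
    rw [← J.val_comp g]
    congr 1
    exact U.2.map_fromSpec (X.affineBasicOpen f).2 _

variable {T : Scheme.{0}} (z : T ⟶ X)

lemma val_comp_fromSpec {U : X.affineOpens} {W : T.affineOpens} (hW : W.1 ≤ z ⁻¹ᵁ U.1) :
    J.val g (W.2.fromSpec ≫ z) = ((J.sheaf g).ideal U).map (z.appLE U.1 W.1 hW).hom := by
  rw [← IsAffineOpen.SpecMap_appLE_fromSpec z U.2 W.2 hW, J.val_comp g]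
  rfl

lemma exists_affineOpens (t : T) : ∃ (U : X.affineOpens) (W : T.affineOpens),
    W.1 ≤ z ⁻¹ᵁ U.1 ∧ t ∈ W.1 := by
  obtain ⟨U, hU, ht, -⟩ := exists_isAffineOpen_mem_and_subset
    (TopologicalSpace.Opens.mem_top (z t))
  obtain ⟨W, hW, ht', hWU⟩ := exists_isAffineOpen_mem_and_subset (show t ∈ z ⁻¹ᵁ U from ht)
  exact ⟨⟨U, hU⟩, ⟨W, hW⟩, hWU, ht'⟩

/-- The right side is the condition for `z` to factor through the closed subscheme. Both sides are
local, and on affine opens `W → U` they say that the ideal on `U` maps to zero on `W`. -/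
lemma ideal_eq_bot_iff : (∀ (R : CommAlgCat.{0} (ZMod p)) (x : Spec (CommRingCat.of R) ⟶ T),
    J.ideal R (x ≫ z) = ⊥) ↔ J.sheaf g ≤ z.ker := by
  constructor
  · intro h
    refine Scheme.IdealSheafData.le_ofIdeals_iff.mpr fun U a ha => ?_
    rw [RingHom.mem_ker]
    refine T.IsSheaf.section_ext fun t ht => ?_
    obtain ⟨W, hW, ht', hWU⟩ := exists_isAffineOpen_mem_and_subset ht
    refine ⟨W, hWU, ht', ?_⟩
    have h1 : J.val g (hW.fromSpec ≫ z) = ⊥ := h (algOf ((hW.fromSpec ≫ z) ≫ g)) hW.fromSpec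
    have h2 := J.val_comp_fromSpec g z (U := U) (W := ⟨W, hW⟩) hWU
    rw [h1] at h2
    have h3 : z.appLE U.1 W hWU a = 0 := h2.ge (Ideal.mem_map_of_mem _ ha)
    rw [map_zero]
    exact h3
  · intro h R x
    have hbot : ∀ (U : X.affineOpens) (W : T.affineOpens) (hW : W.1 ≤ z ⁻¹ᵁ U.1),
        J.val g (W.2.fromSpec ≫ z) = ⊥ := by
      intro U W hW
      rw [J.val_comp_fromSpec g z hW, eq_bot_iff, Ideal.map_le_iff_le_comap]
      intro a ha
      have h1 : z.app U.1 a = 0 := z.ideal_ker_le U (h U ha)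
      rw [Ideal.mem_comap, Scheme.Hom.appLE, CommRingCat.comp_apply, h1, map_zero]
      rfl
    have hT := span_eq_top_of_openCover x {a : R | J.ideal _ (awayMap (p := p) a ≫ x ≫ z) = ⊥}
      fun t => by
        obtain ⟨U, W, hW, ht⟩ := exists_affineOpens z (x t)
        refine ⟨_, W.2.fromSpec, W.2.isOpenImmersion_fromSpec, by rwa [W.2.range_fromSpec], ?_⟩
        rintro a ⟨y, hy⟩
        change J.ideal _ (awayMap (p := p) a ≫ x ≫ z) = ⊥
        rw [← Category.assoc, hy, Category.assoc, ← Spec.map_preimage y, J.ideal_comp g,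
          hbot U W hW, Ideal.map_bot]
    rw [eq_bot_iff]
    intro c hc
    refine Localization.algebraMap_injective_of_span_eq_top _ hT ?_
    ext a
    have h1 : J.ideal _ (awayMap (p := p) a.1 ≫ x ≫ z) = ⊥ := a.2
    rw [J.ideal_map] at h1
    have := h1.le (Ideal.mem_map_of_mem _ hc)
    simpa using this

end AffineIdeal

end

end OrthDL

/-! ### Subfunctors cut out by ideals, and independence of the representing object -/

namespace OrthDL

noncomputable section

variable {p : ℕ} [Fact p.Prime] {F F' F'' : (Over (base p))ᵒᵖ ⥤ Type (max 1 u)}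

lemma inducedHom_eq_of_homEquiv {α : F' ⟶ F} {Y G : Over (base p)} (hY : F'.RepresentableBy Y)
    (hG : F.RepresentableBy G) {f : Y ⟶ G}
    (hf : hG.homEquiv f = α.app (op Y) (hY.homEquiv (𝟙 Y))) : inducedHom α hY hG = f := by
  rw [inducedHom, ← hf, Equiv.symm_apply_apply]

/-- A subfunctor of a representable functor which is defined by the vanishing of an ideal is
represented by a closed subscheme. -/
lemma isRepresentable_and_isClosedImmersion {α : F' ⟶ F}
    (hα : ∀ S, Function.Injective (α.app S)) {G : Over (base p)} (hG : F.RepresentableBy G)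
    (J : AffineIdeal p G.left)
    (hJ : ∀ (S : Over (base p)) (z : S ⟶ G), (∃ s, α.app (op S) s = hG.homEquiv z) ↔
      ∀ (R : CommAlgCat.{0} (ZMod p)) (x : Spec (CommRingCat.of R) ⟶ S.left),
        J.ideal R (x ≫ z.left) = ⊥) :
    ∃ (Z : Over (base p)) (hZ : F'.RepresentableBy Z),
      IsClosedImmersion (inducedHom α hZ hG).left := by
  let I := J.sheaf G.hom
  let Z : Over (base p) := Over.mk (I.subschemeι ≫ G.hom)
  let ι : Z ⟶ G := Over.homMk I.subschemeι
  -- The ideal vanishes on its own zero locus, which yields the universal element over `Z`.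
  obtain ⟨s₀, hs₀⟩ := (hJ Z ι).mpr ((J.ideal_eq_bot_iff G.hom _).mpr I.ker_subschemeι.ge)
  have hcomp : ∀ {S : Over (base p)} (f : S ⟶ Z),
      α.app (op S) (F'.map f.op s₀) = hG.homEquiv (f ≫ ι) := fun f => by
    rw [NatTrans.naturality_apply, hs₀, hG.homEquiv_comp]
  have hbij : ∀ S : Over (base p), Function.Bijective fun f : S ⟶ Z => F'.map f.op s₀ := by
    refine fun S => ⟨fun f f' h => ?_, fun s => ?_⟩
    · have h1 := congrArg (α.app (op S)) h
      rw [hcomp, hcomp] at h1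
      have h2 := congrArg CommaMorphism.left (hG.homEquiv.injective h1)
      exact Over.OverMorphism.ext ((cancel_mono I.subschemeι).mp h2)
    · let z : S ⟶ G := hG.homEquiv.symm (α.app (op S) s)
      have hz : hG.homEquiv z = α.app (op S) s := hG.homEquiv.apply_symm_apply _
      have hle := (J.ideal_eq_bot_iff G.hom _).mp ((hJ S z).mp ⟨s, hz.symm⟩)
      have hker : I.subschemeι.ker ≤ z.left.ker := I.ker_subschemeι.le.trans hle
      let f : S ⟶ Z := Over.homMk (IsClosedImmersion.lift I.subschemeι z.left hker) (by
        change _ ≫ I.subschemeι ≫ G.hom = _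
        rw [IsClosedImmersion.lift_fac_assoc, Over.w])
      refine ⟨f, hα _ ?_⟩
      refine (hcomp f).trans (Eq.trans ?_ hz)
      congr 1
      exact Over.OverMorphism.ext (IsClosedImmersion.lift_fac _ _ _)
  let hZ : F'.RepresentableBy Z :=
    { homEquiv := fun {S} => Equiv.ofBijective _ (hbij S)
      homEquiv_comp := fun f g => by
        change F'.map (f ≫ g).op s₀ = F'.map f.op (F'.map g.op s₀)
        rw [op_comp, Functor.map_comp_apply] }
  refine ⟨Z, hZ, ?_⟩
  rw [inducedHom_eq_of_homEquiv hZ hG (f := ι)]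
  · exact inferInstanceAs (IsClosedImmersion I.subschemeι)
  · rw [← hs₀]
    congr 1
    change _ = F'.map (𝟙 Z).op s₀
    simp

lemma uniqueUpToIso_hom_comp_inducedHom {α : F' ⟶ F} {Y Z G : Over (base p)}
    (hY : F'.RepresentableBy Y) (hZ : F'.RepresentableBy Z) (hG : F.RepresentableBy G) :
    (hY.uniqueUpToIso hZ).hom ≫ inducedHom α hZ hG = inducedHom α hY hG := by
  have h1 : hZ.homEquiv (hY.uniqueUpToIso hZ).hom = hY.homEquiv (𝟙 Y)  :=
    hZ.homEquiv.apply_symm_apply _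
  symm
  refine inducedHom_eq_of_homEquiv hY hG ?_
  rw [hG.homEquiv_comp, inducedHom, Equiv.apply_symm_apply, ← NatTrans.naturality_apply,
    ← hZ.homEquiv_comp, Category.comp_id, h1]

lemma isClosedImmersion_inducedHom {α : F' ⟶ F} {Y Z G : Over (base p)}
    (hY : F'.RepresentableBy Y) (hZ : F'.RepresentableBy Z) (hG : F.RepresentableBy G)
    (h : IsClosedImmersion (inducedHom α hZ hG).left) :
    IsClosedImmersion (inducedHom α hY hG).left := by
  rw [← uniqueUpToIso_hom_comp_inducedHom hY hZ hG, Over.comp_left]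
  have : IsIso (hY.uniqueUpToIso hZ).hom.left :=
    inferInstanceAs (IsIso ((Over.forget _).map (hY.uniqueUpToIso hZ).hom))
  exact (MorphismProperty.cancel_left_of_respectsIso @IsClosedImmersion _ _).mpr h

end

end OrthDL

/-! ### The functors `OGr` and `𝒴_V` -/

namespace OrthDL

noncomputable section

open Module

/-- Transport of a point of a Grassmannian along an equality of ranks. -/
def Grassmannian.cast {R M : Type*} [CommRing R] [AddCommGroup M] [Module R M] {k k' : ℕ}
    (h : k = k') (N : Grassmannian R M k) : Grassmannian R M k' where
  toSubmodule := N.toSubmodule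
  finite_quotient := N.finite_quotient
  projective_quotient := N.projective_quotient
  rankAtStalk_eq q := (N.rankAtStalk_eq q).trans h

lemma Grassmannian.map_cast {F V : Type*} [CommRing F] [AddCommGroup V] [Module F V] {k k' : ℕ}
    {A C : Type w} [CommRing A] [Algebra F A] [CommRing C] [Algebra F C] (h : k = k')
    (N : Grassmannian A (A ⊗[F] V) k) (f : A →ₐ[F] C) :
    (Grassmannian.cast h N).map f = Grassmannian.cast h (N.map f) := by
  subst h
  rfl

variable {p : ℕ} [Fact p.Prime] {V : Type u} [AddCommGroup V] [Module (ZMod p) V] {r : ℕ}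

variable (p V r) in
/-- The Grassmannian functor on `𝔽_{p²}`-schemes. -/
def grOver : (Over (base p))ᵒᵖ ⥤ Type (max 1 u) where
  obj S := Subbundle p V r S.unop.left
  map g := ↾fun L => L.pullback g.unop.left
  map_id S := by
    refine ConcreteCategory.hom_ext _ _ fun L => ?_
    exact Subbundle.pullback_id _
  map_comp g h := by
    refine ConcreteCategory.hom_ext _ _ fun L => ?_
    exact Subbundle.pullback_comp _ _ _

/-- The first component of the universal pair serves as the structure morphism; a morphism over the
base is then the same as the second component alone. -/
lemma isRepresentable_grOver [Module.Finite (ZMod p) V] (hr : r ≤ finrank (ZMod p) V) :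
    (grOver p V r).IsRepresentable := by
  obtain ⟨X, ⟨e⟩⟩ := isRepresentable_grFunctor (p := p) (V := V) hr
  obtain ⟨⟨g, L⟩, hgL⟩ : ∃ y, e.homEquiv (𝟙 X) = y := ⟨_, rfl⟩
  have he : ∀ {S : Scheme.{0}} (f : S ⟶ X), e.homEquiv f = (f ≫ g, L.pullback f) := fun f => by
    rw [e.homEquiv_eq, hgL]
    rfl
  have hbij : ∀ S : Over (base p), Function.Bijective
      fun f : S ⟶ Over.mk g => L.pullback f.left := by
    refine fun S => ⟨fun f f' h => ?_, fun L' => ?_⟩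
    · refine Over.OverMorphism.ext (e.homEquiv.injective ?_)
      rw [he, he]
      exact Prod.ext ((Over.w f).trans (Over.w f').symm) h
    · obtain ⟨f, hf⟩ := e.homEquiv.surjective (S.hom, L')
      rw [he] at hf
      exact ⟨Over.homMk f (congrArg Prod.fst hf), congrArg Prod.snd hf⟩
  refine ⟨Over.mk g, ⟨⟨fun {S} => Equiv.ofBijective _ (hbij S), fun f f' => ?_⟩⟩⟩
  exact Subbundle.pullback_comp _ _ _

variable {B : LinearMap.BilinForm (ZMod p) V}

namespace Subbundle

variable {S : Scheme.{0}}

variable (B) in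
/-- The ideal generated by the values of the form on a pair of subbundles. -/
def pairAffineIdeal {r' : ℕ} (L : Subbundle p V r S) (L' : Subbundle p V r' S) :
    AffineIdeal p S where
  ideal R x := pairIdeal B (L.at' R x) (L'.at' R x)
  ideal_map f x := by
    rw [at', at', L.fiber_map, L'.fiber_map]
    exact pairIdeal_map _ _ _

variable (B) in
/-- The ideal generated by the two by two minors of the pairing of two subbundles. -/
def minorAffineIdeal (L L' : Subbundle p V r S) : AffineIdeal p S where
  ideal R x := minorIdeal B (L.at' R x) (L'.at' R x)
  ideal_map f x := by
    rw [at', at', L.fiber_map, L'.fiber_map]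
    exact minorIdeal_map _ _ _

lemma frob_fiber (L : Subbundle p V r S) (R : CommAlgCat.{0} (ZMod p))
    (x : Spec (CommRingCat.of R) ⟶ S) :
    L.frob.fiber R x = (L.fiber R x).map (FiniteField.frobeniusAlgHom (ZMod p) R) :=
  L.fiber_map _ _

lemma IsIsotropic.frob {L : Subbundle p V r S} (hL : L.IsIsotropic B) : L.frob.IsIsotropic B :=
  fun R _ => hL R _

section Isotropic

variable {d : ℕ}

lemma minorAffineIdeal_eq_bot_of_isSub (hV : finrank (ZMod p) V = 2 * (d + 1))
    {L L' : Subbundle p V (d + 1) S} (hL' : L'.IsIsotropic B) {M : Subbundle p V d S}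
    (hM : M.IsSub L) (hM' : M.IsSub L') (R : CommAlgCat.{0} (ZMod p))
    (x : Spec (CommRingCat.of R) ⟶ S) : (minorAffineIdeal B L L').ideal R x = ⊥ :=
  minorIdeal_eq_bot_of_le (hL' R x) (hM R x)
    -- With truncated subtraction, the two expressions for the quotient rank of `M` agree only
    -- because `d + 1` is at most the dimension.
    (L := Grassmannian.cast (by omega : _ = finrank (ZMod p) V - (d + 1) + 1) (M.fiber R x))
    (hM' R x)

variable [FiniteDimensional (ZMod p) V] {L : Subbundle p V (d + 1) S}

lemma rankOnePair_frob (hV : finrank (ZMod p) V = 2 * (d + 1)) (hB : B.Nondegenerate)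
    (hsplit : ¬ IsSplit B (d + 1)) (hL : L.IsIsotropic B) {R : CommAlgCat.{0} (ZMod p)}
    {x : Spec (CommRingCat.of R) ⟶ S} (hx : (minorAffineIdeal B L L.frob).ideal R x = ⊥) :
    RankOnePair B (L.fiber R x) (L.frob.fiber R x) where
  left := hL R x
  right := hL.frob R x
  pair := by
    have hk : finrank (ZMod p) V - (d + 1) = d + 1 := by omega
    rw [frob_fiber]
    exact pairIdeal_map_frobenius_eq_top hB (by omega)
      (fun ⟨W, hW, h⟩ => hsplit ⟨W, hW.trans hk, h⟩) (hL R x)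
  minor := hx

lemma exists_YV_iff (hV : finrank (ZMod p) V = 2 * (d + 1)) (hB : B.Nondegenerate)
    (hsplit : ¬ IsSplit B (d + 1)) (hL : L.IsIsotropic B) :
    (∃ M : Subbundle p V d S, M.IsIsotropic B ∧ L.IsIsotropic B ∧ M.IsSub L ∧ M.IsSub L.frob ∧
      L.SumIsSummand L.frob) ↔
      ∀ (R : CommAlgCat.{0} (ZMod p)) (x : Spec (CommRingCat.of R) ⟶ S),
        (minorAffineIdeal B L L.frob).ideal R x = ⊥ := by
  have hV' : finrank (ZMod p) V = 2 * (finrank (ZMod p) V - (d + 1)) := by omega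
  constructor
  · rintro ⟨M, -, -, hM, hM', -⟩ R x
    exact minorAffineIdeal_eq_bot_of_isSub hV hL.frob hM hM' R x
  · intro h
    have hk : finrank (ZMod p) V - (d + 1) + 1 = finrank (ZMod p) V - d := by omega
    have hP : ∀ (R : CommAlgCat.{0} (ZMod p)) (x : Spec (CommRingCat.of R) ⟶ S),
      RankOnePair B (L.fiber R x) (L.frob.fiber R x) :=
        fun R x => rankOnePair_frob hV hB hsplit hL (h R x)
    let M : Subbundle p V d S :=
      -- The only possible choice is `L ∩ Frob^*L`; it is a subbundle because the intersection
      -- commutes with base change.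
      { fiber := fun R x => Grassmannian.cast hk ((hP R x).inf hB hV')
        fiber_map := fun f x => by
          rw [Grassmannian.map_cast, RankOnePair.inf_map]
          congr 2
          · exact L.fiber_map f x
          · exact L.frob.fiber_map f x }
    exact ⟨M, fun R x u hu v hv => hL R x u hu.1 v hv.1, hL, fun R x v hv => hv.1,
      fun R x v hv => hv.2, fun R x => (hP R x).exists_isCompl_sup hB hV'⟩

/-- Each of the two lies in `L ∩ Frob^*L`, which has the same rank, so each equals it. Thus the
forgetful map is injective on points. -/
lemma eq_of_isSub_of_isSub_frob (hV : finrank (ZMod p) V = 2 * (d + 1)) (hB : B.Nondegenerate)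
    (hsplit : ¬ IsSplit B (d + 1)) (hL : L.IsIsotropic B) {M M' : Subbundle p V d S}
    (hM : M.IsSub L) (hMf : M.IsSub L.frob) (hM' : M'.IsSub L) (hMf' : M'.IsSub L.frob) :
    M = M' := by
  have hV' : finrank (ZMod p) V = 2 * (finrank (ZMod p) V - (d + 1)) := by omega
  have hk : finrank (ZMod p) V - (d + 1) + 1 = finrank (ZMod p) V - d := by omega
  ext R x : 3
  have hP := rankOnePair_frob hV hB hsplit hL
    (minorAffineIdeal_eq_bot_of_isSub hV hL.frob hM hMf R x)
  have key : ∀ {M : Subbundle p V d S}, M.IsSub L → M.IsSub L.frob →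
      M.fiber R x = Grassmannian.cast hk (hP.inf hB hV') := fun h h' =>
    Grassmannian.eq_of_le fun v hv => ⟨h R x hv, h' R x hv⟩
  rw [key hM hMf, key hM' hMf']

end Isotropic

end Subbundle

lemma isRepresentable_OGr [Module.Finite (ZMod p) V] (hr : r ≤ finrank (ZMod p) V) :
    (OGr B r).IsRepresentable := by
  obtain ⟨G, ⟨hG⟩⟩ := isRepresentable_grOver (p := p) (V := V) hr
  let α : OGr B r ⟶ grOver p V r :=
    { app := fun _ => ↾fun L => L.1
      naturality := fun _ _ _ => rfl }
  let L : Subbundle p V r G.left := hG.homEquiv (𝟙 G)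
  have hL : ∀ {S : Over (base p)} (z : S ⟶ G), hG.homEquiv z = L.pullback z.left :=
    fun z => hG.homEquiv_eq z
  obtain ⟨Z, hZ, -⟩ := isRepresentable_and_isClosedImmersion (α := α)
    (fun S => Subtype.val_injective) hG (L.pairAffineIdeal B L) fun S z => by
      rw [hL]
      constructor
      · rintro ⟨s, hs⟩ R x
        refine pairIdeal_eq_bot_iff.mpr ?_
        have hs' : s.1 = L.pullback z.left := hs
        have := s.2 R x
        rw [hs'] at this
        exact this
      · exact fun h => ⟨⟨L.pullback z.left, fun R x => pairIdeal_eq_bot_iff.mp (h R x)⟩, rfl⟩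
  exact ⟨Z, ⟨hZ⟩⟩

lemma exists_representableBy_YV [FiniteDimensional (ZMod p) V] {d : ℕ}
    (hV : finrank (ZMod p) V = 2 * (d + 1)) (hB : B.Nondegenerate) (hsplit : ¬ IsSplit B (d + 1))
    {G : Over (base p)} (hG : (OGr B (d + 1)).RepresentableBy G) :
    ∃ (Z : Over (base p)) (hZ : (YV B d).RepresentableBy Z),
      IsClosedImmersion (inducedHom (forget B d) hZ hG).left := by
  let L : Subbundle p V (d + 1) G.left := (hG.homEquiv (𝟙 G)).1
  refine isRepresentable_and_isClosedImmersion ?_ hG (L.minorAffineIdeal B L.frob) fun S z => ?_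
  · rintro S ⟨⟨M, N⟩, h⟩ ⟨⟨M', N'⟩, h'⟩ heq
    obtain rfl : N = N' := congrArg Subtype.val heq
    obtain rfl : M = M' := Subbundle.eq_of_isSub_of_isSub_frob hV hB hsplit h.2.1 h.2.2.1
      h.2.2.2.1 h'.2.2.1 h'.2.2.2.1
    rfl
  · obtain ⟨N, hN⟩ : ∃ N, hG.homEquiv z = N := ⟨_, rfl⟩
    have hLN : L.pullback z.left = N.1 := by
      rw [← hN, hG.homEquiv_eq z]
      rfl
    refine Iff.trans ?_ ((Subbundle.exists_YV_iff hV hB hsplit N.2).trans ?_)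
    · rw [hN]
      constructor
      · rintro ⟨⟨⟨M, N'⟩, h⟩, rfl⟩
        exact ⟨M, h⟩
      · rintro ⟨M, h⟩
        exact ⟨⟨(M, N.1), h⟩, rfl⟩
    · rw [← hLN]
      refine forall₂_congr fun R x => ?_
      -- Twisting the pull-back along `z` is pulling back the twist, so the condition on `S` is the
      -- vanishing of the universal minor ideal along `z`.
      change minorIdeal B (L.at' R (x ≫ z.left))
        (L.at' R ((specMap p (frobRing p R) ≫ x) ≫ z.left)) = ⊥ ↔ _
      rw [Category.assoc]
      rfl

end

end OrthDL

theorem lemma2p2 (p : ℕ) [Fact p.Prime] (hp : 2 < p) (d : ℕ)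
    (V : Type u) [AddCommGroup V] [Module (ZMod p) V]
    (hV : Module.finrank (ZMod p) V = 2 * (d + 1))
    (B : LinearMap.BilinForm (ZMod p) V) (hsymm : B.IsSymm) (hnondeg : B.Nondegenerate)
    (hnonsplit : ¬ OrthDL.IsSplit B (d + 1)) :
    (OrthDL.OGr B (d + 1)).IsRepresentable ∧ (OrthDL.YV B d).IsRepresentable ∧
      ∀ {Y G : Over (OrthDL.base p)} (hY : (OrthDL.YV B d).RepresentableBy Y)
        (hG : (OrthDL.OGr B (d + 1)).RepresentableBy G),
        IsClosedImmersion (OrthDL.inducedHom (OrthDL.forget B d) hY hG).left := by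
  -- `finrank` is zero for an infinite-dimensional space, so the positive value `2 * (d + 1)` forces
  -- finiteness.
  have : Module.Finite (ZMod p) V := Module.finite_of_finrank_pos (by omega)
  have hOGr : (OrthDL.OGr B (d + 1)).IsRepresentable := OrthDL.isRepresentable_OGr (by omega)
  refine ⟨hOGr, ?_, fun {Y G} hY hG => ?_⟩
  · obtain ⟨G, ⟨hG⟩⟩ := hOGr
    obtain ⟨Z, hZ, -⟩ := OrthDL.exists_representableBy_YV hV hnondeg hnonsplit hG
    exact ⟨Z, ⟨hZ⟩⟩
  · obtain ⟨Z, hZ, h⟩ := OrthDL.exists_representableBy_YV hV hnondeg hnonsplit hG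
    exact OrthDL.isClosedImmersion_inducedHom hY hZ hG h
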